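/- All rings are commutative with unity; all monoids are commutative, cancellative and torsion-free ($x^k=y^k$ with $k\ge 1$ implies $x=y$). A monoid is \emph{positive} if its only unit is $1$, and \emph{affine} if it is finitely generated. For a ring extension $A\subset B$ let $\mathcal I(A,B)$ denote the group, under multiplication, of invertible $A$-submodules of $B$, i.e. of the $A$-submodules $I\subset B$ such that $IJ=A$ for some $A$-submodule $J\subset B$. A ring extension $A\subset C$ is \emph{elementary subintegral} if $C=A[b]$ for some $b$ with $b^2,b^3\in A$; it is \emph{subintegral} if $C$ is a union of subrings each obtained from $A$ by a finite succession of elementary subintegral extensions. The largest subintegral extension of $A$ in $B$ is the \emph{subintegral closure} of $A$ in $B$, and $A$ is \emph{subintegrally closed} in $B$ if it equals its subintegral closure in $B$. Likewise, an extension of monoids $M\subset L$ is elementary subintegral if $L=M\cup xM$ for some $x$ with $x^2,x^3\in M$, and subintegral extensions, the subintegral closure of $M$ in $N$ and "$M$ is subintegrally closed in $N$" are defined from this in the same way. \textbf{Theorem.} Let $A\subset B$ be an extension of rings and $M\subset N$ an extension of positive monoids. Let $$\theta:\mathcal I(A,B)\to\mathcal I(A[M],B[N])$$ be the canonical group homomorphism,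 which sends $I$ to the $A[M]$-submodule of $B[N]$ generated by $I$. (a) If $A[M]$ is subintegrally closed in $B[N]$ and $N$ is affine, then $\theta$ is an isomorphism. (b) If $B$ is reduced, $A$ is subintegrally closed in $B$ and $M$ is subintegrally closed in $N$, then $\theta$ is an isomorphism. (c) If $M=N$ and $A$ is subintegrally closed in $B$, then $\theta$ is an isomorphism. (d) Conversely, suppose that $\theta$ is an isomorphism. Then $B$ is reduced or $M=N$. If moreover $M\neq\{1\}$, then $A$ is subintegrally closed in $B$ and $A[M]$ is subintegrally closed in $B[N]$. -/

import Mathlib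

/-! Subintegral extensions of rings -/

/-- For subrings `C`, `D` of a commutative ring, `C ⊆ D` is an elementary subintegral extension:
`D = C[b]` for some `b` with `b ^ 2, b ^ 3 ∈ C`. -/
def Subring.IsElementarySubintegral {B : Type*} [CommRing B] (C D : Subring B) : Prop :=
  ∃ b : B, b ^ 2 ∈ C ∧ b ^ 3 ∈ C ∧ D = Subring.closure (insert b (C : Set B))

/-- `D` is obtained from `C` by a finite (possibly empty) succession of elementary subintegral
extensions. -/
def Subring.IsFinitelySubintegral {B : Type*} [CommRing B] (C D : Subring B) : Prop :=
  Relation.ReflTransGen Subring.IsElementarySubintegral C D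

/-- `A ⊆ C` is a subintegral extension: `C` is the union of subrings, each of which is obtained
from `A` by a finite succession of elementary subintegral extensions. -/
def Subring.IsSubintegral {B : Type*} [CommRing B] (A C : Subring B) : Prop :=
  ∃ S : Set (Subring B), (∀ D ∈ S, A.IsFinitelySubintegral D) ∧
    (C : Set B) = ⋃ D ∈ S, (D : Set B)

/-- The subintegral closure of `A` in `B`: the largest subintegral extension of `A` in `B`
(see `Subring.isGreatest_subintegralClosure`). -/
def Subring.subintegralClosure {B : Type*} [CommRing B] (A : Subring B) : Subring B :=
  sSup {C : Subring B | A.IsSubintegral C}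

/-- `A` is subintegrally closed in `B`. -/
def Subring.IsSubintegrallyClosed {B : Type*} [CommRing B] (A : Subring B) : Prop :=
  A.subintegralClosure = A

theorem Subring.IsElementarySubintegral.sup {B : Type*} [CommRing B] {C D : Subring B}
    (h : C.IsElementarySubintegral D) (E : Subring B) :
    (C ⊔ E).IsElementarySubintegral (D ⊔ E) := by
  obtain ⟨b, h2, h3, rfl⟩ := h
  refine ⟨b, le_sup_left (a := C) h2, le_sup_left (a := C) h3, ?_⟩
  simp only [Set.insert_eq, Subring.closure_union, Subring.closure_eq]
  exact sup_assoc _ _ _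

theorem Subring.IsFinitelySubintegral.sup {B : Type*} [CommRing B] {A C D : Subring B}
    (hC : A.IsFinitelySubintegral C) (hD : A.IsFinitelySubintegral D) :
    A.IsFinitelySubintegral (C ⊔ D) := by
  have le : A ≤ D := by
    clear hC
    induction hD with
    | refl => exact le_rfl
    | tail _ h ih =>
      obtain ⟨b, -, -, rfl⟩ := h
      exact ih.trans fun x hx => Subring.subset_closure (Set.mem_insert_of_mem _ hx)
  have h : (A ⊔ D).IsFinitelySubintegral (C ⊔ D) :=
    Relation.ReflTransGen.lift (· ⊔ D) (fun _ _ h => h.sup D) _ _ hC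
  rw [sup_eq_right.mpr le] at h
  exact Relation.ReflTransGen.trans hD h

theorem Subring.isGreatest_subintegralClosure {B : Type*} [CommRing B] (A : Subring B) :
    IsGreatest {C : Subring B | A.IsSubintegral C} A.subintegralClosure := by
  refine ⟨⟨{D | A.IsFinitelySubintegral D}, fun D hD => hD, ?_⟩, fun C hC => le_sSup hC⟩
  have hdir : DirectedOn (· ≤ ·) {D : Subring B | A.IsFinitelySubintegral D} :=
    fun C hC D hD => ⟨C ⊔ D, hC.sup hD, le_sup_left, le_sup_right⟩
  have hne : {D : Subring B | A.IsFinitelySubintegral D}.Nonempty :=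
    ⟨A, Relation.ReflTransGen.refl⟩
  have key : A.subintegralClosure = sSup {D : Subring B | A.IsFinitelySubintegral D} := by
    apply le_antisymm
    · refine sSup_le ?_
      rintro C ⟨S, hS, hC⟩ x hx
      have hx' : x ∈ (C : Set B) := hx
      rw [hC] at hx'
      obtain ⟨D, hD, hxD⟩ := Set.mem_iUnion₂.mp hx'
      exact le_sSup (a := D) (hS D hD) hxD
    · refine sSup_le fun D hD => le_sSup ⟨{D}, by simpa using hD, by simp⟩
  ext x
  rw [key, SetLike.mem_coe, Subring.mem_sSup_of_directedOn hne hdir]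
  simp

/-! Subintegral extensions of monoids -/

/-- For submonoids `C`, `D` of a commutative monoid, `C ⊆ D` is an elementary subintegral
extension: `D = C ∪ xC` for some `x` with `x ^ 2, x ^ 3 ∈ C`. -/
def Submonoid.IsElementarySubintegral {N : Type*} [CommMonoid N] (C D : Submonoid N) : Prop :=
  ∃ x : N, x ^ 2 ∈ C ∧ x ^ 3 ∈ C ∧ (D : Set N) = (C : Set N) ∪ (fun c => x * c) '' (C : Set N)

/-- `D` is obtained from `C` by a finite (possibly empty) succession of elementary subintegral
extensions. -/
def Submonoid.IsFinitelySubintegral {N : Type*} [CommMonoid N] (C D : Submonoid N) : Prop :=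
  Relation.ReflTransGen Submonoid.IsElementarySubintegral C D

/-- `M ⊆ C` is a subintegral extension: `C` is the union of submonoids, each of which is obtained
from `M` by a finite succession of elementary subintegral extensions. -/
def Submonoid.IsSubintegral {N : Type*} [CommMonoid N] (M C : Submonoid N) : Prop :=
  ∃ S : Set (Submonoid N), (∀ D ∈ S, M.IsFinitelySubintegral D) ∧
    (C : Set N) = ⋃ D ∈ S, (D : Set N)

/-- The subintegral closure of `M` in `N`: the largest subintegral extension of `M` in `N`
(see `Submonoid.isGreatest_subintegralClosure`). -/
def Submonoid.subintegralClosure {N : Type*} [CommMonoid N] (M : Submonoid N) : Submonoid N :=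
  sSup {C : Submonoid N | M.IsSubintegral C}

/-- `M` is subintegrally closed in `N`. -/
def Submonoid.IsSubintegrallyClosed {N : Type*} [CommMonoid N] (M : Submonoid N) : Prop :=
  M.subintegralClosure = M

theorem Submonoid.IsElementarySubintegral.sup {N : Type*} [CommMonoid N] {C D : Submonoid N}
    (h : C.IsElementarySubintegral D) (E : Submonoid N) :
    (C ⊔ E).IsElementarySubintegral (D ⊔ E) := by
  obtain ⟨x, h2, h3, hD⟩ := h
  have hD' : ∀ y, y ∈ D ↔ y ∈ C ∨ ∃ c ∈ C, x * c = y := fun y => by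
    rw [← SetLike.mem_coe, hD]; simp
  refine ⟨x, le_sup_left (a := C) h2, le_sup_left (a := C) h3, ?_⟩
  ext z
  simp only [SetLike.mem_coe, Set.mem_union, Set.mem_image, Submonoid.mem_sup, hD']
  constructor
  · rintro ⟨y, hy | ⟨c, hc, rfl⟩, e, he, rfl⟩
    · exact Or.inl ⟨y, hy, e, he, rfl⟩
    · exact Or.inr ⟨c * e, ⟨c, hc, e, he, rfl⟩, (mul_assoc _ _ _).symm⟩
  · rintro (⟨y, hy, e, he, rfl⟩ | ⟨_, ⟨c, hc, e, he, rfl⟩, rfl⟩)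
    · exact ⟨y, Or.inl hy, e, he, rfl⟩
    · exact ⟨x * c, Or.inr ⟨c, hc, rfl⟩, e, he, mul_assoc _ _ _⟩

theorem Submonoid.IsFinitelySubintegral.sup {N : Type*} [CommMonoid N] {M C D : Submonoid N}
    (hC : M.IsFinitelySubintegral C) (hD : M.IsFinitelySubintegral D) :
    M.IsFinitelySubintegral (C ⊔ D) := by
  have le : M ≤ D := by
    clear hC
    induction hD with
    | refl => exact le_rfl
    | tail _ h ih =>
      obtain ⟨b, -, -, h⟩ := h
      refine ih.trans fun x hx => ?_
      rw [← SetLike.mem_coe, h]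
      exact Or.inl hx
  have h : (M ⊔ D).IsFinitelySubintegral (C ⊔ D) :=
    Relation.ReflTransGen.lift (· ⊔ D) (fun _ _ h => h.sup D) _ _ hC
  rw [sup_eq_right.mpr le] at h
  exact Relation.ReflTransGen.trans hD h

theorem Submonoid.isGreatest_subintegralClosure {N : Type*} [CommMonoid N] (M : Submonoid N) :
    IsGreatest {C : Submonoid N | M.IsSubintegral C} M.subintegralClosure := by
  refine ⟨⟨{D | M.IsFinitelySubintegral D}, fun D hD => hD, ?_⟩, fun C hC => le_sSup hC⟩
  have hdir : DirectedOn (· ≤ ·) {D : Submonoid N | M.IsFinitelySubintegral D} :=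
    fun C hC D hD => ⟨C ⊔ D, hC.sup hD, le_sup_left, le_sup_right⟩
  have hne : {D : Submonoid N | M.IsFinitelySubintegral D}.Nonempty :=
    ⟨M, Relation.ReflTransGen.refl⟩
  have key : M.subintegralClosure = sSup {D : Submonoid N | M.IsFinitelySubintegral D} := by
    apply le_antisymm
    · refine sSup_le ?_
      rintro C ⟨S, hS, hC⟩ x hx
      have hx' : x ∈ (C : Set N) := hx
      rw [hC] at hx'
      obtain ⟨D, hD, hxD⟩ := Set.mem_iUnion₂.mp hx'
      exact le_sSup (a := D) (hS D hD) hxD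
    · refine sSup_le fun D hD => le_sSup ⟨{D}, by simpa using hD, by simp⟩
  ext x
  rw [key, SetLike.mem_coe, Submonoid.mem_sSup_of_directedOn hne hdir]
  simp

/-! The monoid algebra `A[M]` inside `B[N]` -/

/-- For a subring `A` of `B` and a submonoid `M` of `N`, the monoid algebra `A[M]`, as a subring
of `B[N]`: the image of the ring homomorphism `A[M] → B[N]` induced by the inclusions. -/
noncomputable def Subring.monoidAlgebra {B : Type*} [CommRing B] (A : Subring B)
    {N : Type*} [CommMonoid N] (M : Submonoid N) : Subring (MonoidAlgebra B N) :=
  ((MonoidAlgebra.mapDomainRingHom B M.subtype).comp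
    (MonoidAlgebra.mapRingHom M A.subtype)).range

theorem Subring.le_comap_monoidAlgebra {B : Type*} [CommRing B] (A : Subring B)
    {N : Type*} [CommMonoid N] (M : Submonoid N) :
    A ≤ (A.monoidAlgebra M).comap MonoidAlgebra.singleOneRingHom := by
  intro a ha
  refine ⟨MonoidAlgebra.single 1 ⟨a, ha⟩, ?_⟩
  simp [MonoidAlgebra.singleOneRingHom]

/-! The group of invertible submodules -/

/-- The group `𝓘(A, B)` of invertible `A`-submodules of `B`: the `A`-submodules `I` of `B` such
that `I * J = A` for some `A`-submodule `J` of `B`, under multiplication of submodules. -/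
abbrev InvertibleSubmodules {B : Type*} [CommRing B] (A : Subring B) : Type _ :=
  (Submodule A B)ˣ

/-- For a morphism of ring extensions `φ : (A, B) → (A', B')`, i.e. a ring homomorphism
`φ : B → B'` with `φ(A) ⊆ A'`, the induced multiplicative map sending an `A`-submodule `I` of `B`
to the `A'`-submodule of `B'` generated by `φ(I)`. -/
def Submodule.extendAlong {B B' : Type*} [CommRing B] [CommRing B'] {A : Subring B}
    {A' : Subring B'} (φ : B →+* B') (hφ : A ≤ A'.comap φ) :
    Submodule A B →* Submodule A' B' where
  toFun I := Submodule.span A' (φ '' (I : Set B))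
  map_one' := by
    apply le_antisymm
    · rw [Submodule.span_le]
      rintro _ ⟨x, hx, rfl⟩
      obtain ⟨a, rfl⟩ := Submodule.mem_one.mp hx
      exact Submodule.mem_one.mpr ⟨⟨φ a, hφ a.2⟩, rfl⟩
    · rw [Submodule.one_le]
      exact Submodule.subset_span ⟨1, Submodule.one_le.mp le_rfl, map_one φ⟩
  map_mul' I J := by
    rw [Submodule.span_mul_span]
    apply le_antisymm
    · rw [Submodule.span_le]
      rintro _ ⟨x, hx, rfl⟩
      induction hx using Submodule.mul_induction_on' with
      | mem_mul_mem m hm n hn =>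
        rw [map_mul]
        exact Submodule.subset_span (Set.mul_mem_mul ⟨m, hm, rfl⟩ ⟨n, hn, rfl⟩)
      | add x _ y _ hx hy =>
        rw [map_add]
        exact add_mem hx hy
    · rw [Submodule.span_le]
      rintro _ ⟨_, ⟨m, hm, rfl⟩, _, ⟨n, hn, rfl⟩, rfl⟩
      exact Submodule.subset_span ⟨m * n, Submodule.mul_mem_mul hm hn, map_mul φ m n⟩

/-- The group homomorphism `𝓘(φ) : 𝓘(A, B) → 𝓘(A', B')` induced by a morphism of ring extensions
`φ : (A, B) → (A', B')`. -/
def InvertibleSubmodules.map {B B' : Type*} [CommRing B] [CommRing B'] {A : Subring B}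
    {A' : Subring B'} (φ : B →+* B') (hφ : A ≤ A'.comap φ) :
    InvertibleSubmodules A →* InvertibleSubmodules A' :=
  Units.map (Submodule.extendAlong φ hφ)

/-- The canonical homomorphism `𝓘(A, B) → 𝓘(A[M], B[N])` induced by the inclusion `B → B[N]`. -/
noncomputable def InvertibleSubmodules.toMonoidAlgebra {B : Type*} [CommRing B] (A : Subring B)
    {N : Type*} [CommMonoid N] (M : Submonoid N) :
    InvertibleSubmodules A →* InvertibleSubmodules (A.monoidAlgebra M) :=
  InvertibleSubmodules.map MonoidAlgebra.singleOneRingHom (A.le_comap_monoidAlgebra M)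

/-! Linear functionals that are positive on given vectors -/

/-! Since `N` is positive, killing every element of `N` except `1` is a retraction of `(A[M], B[N])`
onto `(A, B)`. Hence `θ` is injective, and it is bijective exactly when every invertible submodule
with augmentation `A` is trivial. Such a submodule is handled through finite families `f`, `g` with
all `f i * g j` in `A[M]` and `∑ i, f i * g i = 1` (`InvertibleSubmodules.bijective_map_iff`).

For (a), finitely many elements have supports in a finitely generated submonoid, and this has a
grading by `ℕ` in which only `1` has degree zero. The substitution `n ↦ n X ^ d n` makes the
families polynomials over a ring `S` whose constant terms lie in a subintegrally closed subring `R`.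
It remains to see that they are polynomials over `R`
(`Polynomial.mem_lifts_of_forall_mul_mem_lifts`). Their coefficients are integral over `R`, so `S`
may be taken finite over `R`. Subintegral closedness makes the conductor radical. At a minimal prime
over the contraction of a proper conductor, the quotient of `S` by the conductor becomes a reduced
algebra over a field, where the claim holds because `k[X]` is principal. Clearing denominators then
puts into the conductor an element of `R` outside that prime, a contradiction.

Parts (b) and (c) follow once `A[M]` is known to be subintegrally closed. If `x ^ 2` and `x ^ 3` are
in `A[M]`, the coefficients of `x` are in `A` by a substitution into `B[X]` and the polynomial
result. For reduced `B`, the support of `x` is in `M` by an argument over domains with extremal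
monomials, the group generated by `M`, and faces (`MonoidAlgebra.mem_of_sq_of_cube_of_isReduced`).

For (d), if `x ^ 2` and `x ^ 3` lie in a subring, then `1 - x` and `x ^ 2` generate an invertible
submodule, because `(1 - x) * ((1 + x) * (1 + x ^ 2)) + x ^ 4 = 1`. When the augmentation of `x` is
in `A`, bijectivity of `θ` forces `x` into `A[M]`. Monomials are the test elements. -/

theorem eventually_natCast_mul_add_pos {a : ℚ} (ha : 0 < a) (b : ℚ) :
    ∀ᶠ K : ℕ in Filter.atTop, 0 < (K : ℚ) * a + b := by
  obtain ⟨k, hk⟩ := exists_nat_gt (-b / a)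
  filter_upwards [Filter.eventually_ge_atTop k] with K hK
  have h1 : -b / a < K := hk.trans_le (by exact_mod_cast hK)
  rw [div_lt_iff₀ ha] at h1
  linarith

theorem eventually_natCast_mul_add_ne_zero {a b : ℚ} (h : a ≠ 0 ∨ b ≠ 0) :
    ∀ᶠ K : ℕ in Filter.atTop, (K : ℚ) * a + b ≠ 0 := by
  rcases lt_trichotomy a 0 with ha | rfl | ha
  · filter_upwards [eventually_natCast_mul_add_pos (neg_pos.mpr ha) (-b)] with K hK h0
    linarith
  · simp at h
    simp [h]
  · filter_upwards [eventually_natCast_mul_add_pos ha b] with K hK using hK.ne'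

/-- **Gordan's theorem**: finitely many vectors of a rational vector space satisfying no nontrivial
relation with nonnegative coefficients lie in an open half-space. -/
theorem exists_dual_pos {V ι : Type*} [AddCommGroup V] [Module ℚ V] (s : Finset ι) (v : ι → V)
    (h : ∀ c : ι → ℕ, ∑ i ∈ s, c i • v i = 0 → ∀ i ∈ s, c i = 0) :
    ∃ f : Module.Dual ℚ V, ∀ i ∈ s, 0 < f (v i) := by
  classical
  induction s using Finset.induction generalizing v with
  | empty => exact ⟨0, by simp⟩
  | insert r s hr ih =>
    have hvr : v r ≠ 0 := fun h0 => by
      have := h (Pi.single r 1) (by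
        refine Finset.sum_eq_zero fun i hi => ?_
        by_cases hir : i = r
        · rw [hir, h0, smul_zero]
        · rw [Pi.single_eq_of_ne hir, zero_smul]) r (by simp)
      simp at this
    obtain ⟨φ, hφ⟩ : ∃ φ : Module.Dual ℚ V, φ (v r) = 1 := by
      obtain ⟨φ, hφ⟩ := not_forall.mp (mt (Module.forall_dual_apply_eq_zero_iff ℚ (v r)).mp hvr)
      exact ⟨(φ (v r))⁻¹ • φ, by simp [hφ]⟩
    let π : V →ₗ[ℚ] V := LinearMap.id - φ.smulRight (v r)
    have hπ : ∀ x, π x = x - φ x • v r := fun x => by simp [π]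
    -- `π` projects along `v r`. If the projected vectors satisfy no relation, a functional positive
    -- on them is pulled back, scaled up and corrected by `φ`, which is `1` on `v r`. Otherwise a
    -- relation makes `t • v r` a nonnegative combination of the other vectors with `t > 0`, so
    -- positivity on those suffices.
    by_cases hq : ∀ c : ι → ℕ, ∑ i ∈ s, c i • π (v i) = 0 → ∀ i ∈ s, c i = 0
    · obtain ⟨g, hg⟩ := ih (fun i => π (v i)) hq
      obtain ⟨K, hK⟩ := ((Filter.eventually_all_finset s).mpr fun i hi =>
        eventually_natCast_mul_add_pos (hg i hi) (φ (v i))).exists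
      refine ⟨(K : ℚ) • g ∘ₗ π + φ, fun i hi => ?_⟩
      rcases Finset.mem_insert.mp hi with rfl | hi
      · simp [hπ, hφ]
      · simpa using hK i hi
    · push Not at hq
      obtain ⟨c, hc, j, hj, hcj⟩ := hq
      obtain ⟨f, hf⟩ := ih v fun c' hc' i hi => by
        have := h (Function.update c' r 0) (by
          rw [Finset.sum_insert hr, ← hc']
          simp only [Function.update_self, zero_smul, zero_add]
          refine Finset.sum_congr rfl fun i hi => ?_
          rw [Function.update_of_ne (ne_of_mem_of_not_mem hi hr)]) i (by simp [hi])
        rwa [Function.update_of_ne (ne_of_mem_of_not_mem hi hr)] at this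
      set t := φ (∑ i ∈ s, c i • v i) with ht
      have hsum : ∑ i ∈ s, c i • v i = t • v r := by
        have : π (∑ i ∈ s, c i • v i) = 0 := by simpa using hc
        rw [hπ, sub_eq_zero] at this
        exact this
      have htpos : 0 < t := by
        by_contra! hneg
        -- For `t ≤ 0`, clearing the denominator of `t` gives a forbidden relation with coefficients
        -- `t.den * c i` on `s` and `|t.num|` on `r`.
        have hnum : (t.num.natAbs : ℚ) = -(t.den * t) := by
          have h1 : (t.den : ℚ) * t = t.num := Rat.den_mul_eq_num t
          have h2 : (t.num.natAbs : ℤ) = -t.num := by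
            have := Rat.num_nonpos.mpr hneg
            omega
          rw [h1, ← Int.cast_natCast, h2, Int.cast_neg]
        have := h (Function.update (fun i => t.den * c i) r t.num.natAbs) (by
          rw [Finset.sum_insert hr, Finset.sum_congr rfl
            (g := fun i => (t.den : ℚ) • (c i • v i)), ← Finset.smul_sum, hsum]
          · rw [Function.update_self, ← Nat.cast_smul_eq_nsmul ℚ, hnum, smul_smul, ← add_smul]
            simp
          · intro i hi
            rw [Function.update_of_ne (ne_of_mem_of_not_mem hi hr), mul_smul,
              Nat.cast_smul_eq_nsmul]) j (by simp [hj])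
        rw [Function.update_of_ne (ne_of_mem_of_not_mem hj hr)] at this
        exact hcj (by simpa using this)
      refine ⟨f, fun i hi => ?_⟩
      rcases Finset.mem_insert.mp hi with rfl | hi
      · have h1 : 0 < ∑ i ∈ s, (c i : ℚ) * f (v i) :=
          Finset.sum_pos' (fun i hi => mul_nonneg (by positivity) (hf i hi).le)
            ⟨j, hj, mul_pos (by positivity) (hf j hj)⟩
        have h2 : ∑ i ∈ s, (c i : ℚ) * f (v i) = t * f (v i) := by
          have := congrArg f hsum
          simpa using this
        rw [h2] at h1
        exact pos_of_mul_pos_right h1 htpos.le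
      · exact hf i hi

theorem exists_dual_pos_ne_zero {V ι κ : Type*} [AddCommGroup V] [Module ℚ V] [Finite κ]
    (s : Finset ι) (v : ι → V) (h : ∀ c : ι → ℕ, ∑ i ∈ s, c i • v i = 0 → ∀ i ∈ s, c i = 0)
    (w : κ → V) (hw : ∀ j, w j ≠ 0) :
    ∃ f : Module.Dual ℚ V, (∀ i ∈ s, 0 < f (v i)) ∧ ∀ j, f (w j) ≠ 0 := by
  obtain ⟨f, hf⟩ := exists_dual_pos s v h
  obtain ⟨g, hg⟩ := Module.exists_dual_forall_apply_ne_zero (K := ℚ) w hw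
  obtain ⟨K, hK, hK'⟩ := (((Filter.eventually_all_finset s).mpr fun i hi =>
    eventually_natCast_mul_add_pos (hf i hi) (g (v i))).and (Filter.eventually_all.mpr fun j =>
    eventually_natCast_mul_add_ne_zero (a := f (w j)) (Or.inr (hg j)))).exists
  exact ⟨(K : ℚ) • f + g, fun i hi => by simpa using hK i hi, fun j => by simpa using hK' j⟩

/-! Homomorphisms from torsion-free monoids to `ℚ` and `ℕ` -/

section

open TensorProduct

variable {N : Type*} [CommMonoid N] [IsCancelMul N] [IsMulTorsionFree N]

/-- The canonical homomorphism from a commutative monoid to a rational vector space. -/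
noncomputable def toRatVectorSpace (N : Type*) [CommMonoid N] :
    Additive N →+ ℚ ⊗[ℤ] Additive (Algebra.GrothendieckGroup N) :=
  (TensorProduct.mk ℤ ℚ (Additive (Algebra.GrothendieckGroup N)) 1).toAddMonoidHom.comp
    (MonoidHom.toAdditive Algebra.GrothendieckGroup.of)

/-- Cancellation embeds `N` in its group of fractions. That group is torsion-free, hence flat over
`ℤ`, so tensoring `ℤ → ℚ` with it preserves injectivity. -/
theorem toRatVectorSpace_injective : Function.Injective (toRatVectorSpace N) := by
  intro x y hxy
  have h1 : Function.Injective
      (TensorProduct.mk ℤ ℚ (Additive (Algebra.GrothendieckGroup N)) 1) := by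
    have h2 := Module.Flat.rTensor_preserves_injective_linearMap
      (M := Additive (Algebra.GrothendieckGroup N)) (Algebra.linearMap ℤ ℚ) (by
        intro a b hab
        simpa using hab)
    have h3 : (TensorProduct.mk ℤ ℚ (Additive (Algebra.GrothendieckGroup N)) 1) =
        (Algebra.linearMap ℤ ℚ).rTensor (Additive (Algebra.GrothendieckGroup N)) ∘ₗ
          (TensorProduct.lid ℤ (Additive (Algebra.GrothendieckGroup N))).symm.toLinearMap := by
      ext; simp
    rw [h3]
    exact h2.comp (TensorProduct.lid ℤ (Additive (Algebra.GrothendieckGroup N))).symm.injective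
  have h4 := h1 hxy
  exact Algebra.GrothendieckGroup.of_injective (M := N) h4

/-- If no nontrivial product of powers of the `a i` equals the corresponding product of powers of
the `b i`, then some homomorphism to `ℚ` is larger on each `a i` than on `b i`; it may be chosen
injective on a given finite set. -/
theorem exists_hom_rat_lt {ι : Type*} (s : Finset ι) (a b : ι → N)
    (h : ∀ c : ι → ℕ, ∏ i ∈ s, a i ^ c i = ∏ i ∈ s, b i ^ c i → ∀ i ∈ s, c i = 0)
    (S : Finset N) :
    ∃ f : Additive N →+ ℚ, (∀ i ∈ s, f (.ofMul (b i)) < f (.ofMul (a i))) ∧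
      Set.InjOn (fun n => f (.ofMul n)) S := by
  let e := toRatVectorSpace N
  have he : Function.Injective e := toRatVectorSpace_injective
  obtain ⟨f, hf, hf'⟩ := exists_dual_pos_ne_zero s
    (fun i => e (.ofMul (a i)) - e (.ofMul (b i))) (fun c hc => h c (by
      simp only [smul_sub, Finset.sum_sub_distrib, ← map_nsmul, ← map_sum, sub_eq_zero] at hc
      exact Additive.ofMul.injective (by simpa using he hc)))
    (fun p : {p : S × S // p.1 ≠ p.2} => e (.ofMul p.1.1.1) - e (.ofMul p.1.2.1))
    (fun p h0 => p.2 (Subtype.ext (Additive.ofMul.injective (he (sub_eq_zero.mp h0)))))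
  refine ⟨f.toAddMonoidHom.comp e, fun i hi => ?_, fun x hx y hy hxy => ?_⟩
  · have := hf i hi
    rw [map_sub, sub_pos] at this
    exact this
  · by_contra hne
    refine hf' ⟨(⟨x, hx⟩, ⟨y, hy⟩), by simpa using hne⟩ ?_
    rw [map_sub, sub_eq_zero]
    exact hxy

/-- A finitely generated positive monoid has a grading by `ℕ` for which only `1` has degree zero;
it may be chosen injective on a given finite set. -/
theorem exists_hom_nat_pos [Subsingleton Nˣ] [hN : Monoid.FG N] (S : Finset N) :
    ∃ d : Additive N →+ ℕ, (∀ n : N, d (.ofMul n) = 0 → n = 1) ∧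
      Set.InjOn (fun n => d (.ofMul n)) S := by
  classical
  obtain ⟨T, hT⟩ := Monoid.fg_def.mp hN
  obtain ⟨f, hf, hfS⟩ := exists_hom_rat_lt (T.erase 1) (id : N → N) (fun _ => 1) (fun c hc i hi => by
    simp only [one_pow, Finset.prod_const_one, id] at hc
    by_contra hci
    -- A nontrivial product of generators equal to `1` would make a generator other than `1` a unit,
    -- against positivity.
    have hu : IsUnit i := by
      have h1 : IsUnit (∏ i ∈ T.erase 1, i ^ c i) := by
        rw [hc]; exact isUnit_one
      rw [← Finset.mul_prod_erase _ _ hi] at h1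
      exact isUnit_of_dvd_unit ((dvd_pow_self i hci).trans (Dvd.intro _ rfl)) h1
    exact (Finset.mem_erase.mp hi).1 (hu.eq_one)) S
  -- `D` is a common denominator of the values on the generators, so `D * f` takes natural values on
  -- all of `N`.
  let D : ℕ := ∏ i ∈ T, (f (.ofMul i)).den
  have hD : 0 < D := Finset.prod_pos fun i _ => (f (.ofMul i)).pos
  have hfT : ∀ i ∈ T, 0 ≤ f (.ofMul i) := fun i hi => by
    by_cases h1 : i = 1
    · subst h1; simp
    · exact (by simpa using hf i (by simp [h1, hi]) : (0 : ℚ) < f (.ofMul i)).le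
  have hnat : ∀ n : N, ∃ k : ℕ, (k : ℚ) = D * f (.ofMul n) := by
    intro n
    have hn : n ∈ Submonoid.closure (T : Set N) := hT ▸ Submonoid.mem_top n
    induction hn using Submonoid.closure_induction with
    | mem i hi =>
      obtain ⟨m, hm⟩ := Finset.dvd_prod_of_mem (fun i => (f (.ofMul i)).den) hi
      refine ⟨m * (f (.ofMul i)).num.natAbs, ?_⟩
      have h1 : ((f (.ofMul i)).den : ℚ) * f (.ofMul i) = (f (.ofMul i)).num :=
        Rat.den_mul_eq_num _
      have h2 : (((f (.ofMul i)).num.natAbs : ℤ) : ℚ) = (f (.ofMul i)).num := by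
        rw [Int.natAbs_of_nonneg (Rat.num_nonneg.mpr (hfT i hi))]
      have h3 : (D : ℚ) = (f (.ofMul i)).den * m := by exact_mod_cast hm
      rw [Nat.cast_mul, ← Int.cast_natCast (R := ℚ) (Int.natAbs _), h2, h3, ← h1]
      ring
    | one => exact ⟨0, by simp⟩
    | mul x y _ _ hx hy =>
      obtain ⟨k, hk⟩ := hx
      obtain ⟨l, hl⟩ := hy
      exact ⟨k + l, by push_cast; rw [hk, hl, ofMul_mul, map_add]; ring⟩
  choose d hd using hnat
  have hpos : ∀ n : N, n ≠ 1 → 0 < f (.ofMul n) := by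
    intro n
    have hn : n ∈ Submonoid.closure (T : Set N) := hT ▸ Submonoid.mem_top n
    induction hn using Submonoid.closure_induction with
    | mem i hi => exact fun h1 => by simpa using hf i (by simp [h1]; exact hi)
    | one => simp
    | mul x y _ _ hx hy =>
      intro hxy
      rw [ofMul_mul, map_add]
      by_cases h1 : x = 1
      · subst h1
        simpa using hy (by simpa using hxy)
      · by_cases h2 : y = 1
        · subst h2
          simpa using hx h1
        · exact add_pos (hx h1) (hy h2)
  refine ⟨⟨⟨fun n => d n.toMul, ?_⟩, fun x y => ?_⟩, fun n hn => ?_, fun x hx y hy hxy => ?_⟩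
  · have := hd 1
    simp at this
    simpa using this
  · have : ((d (x + y).toMul : ℕ) : ℚ) = (d x.toMul + d y.toMul : ℕ) := by
      push_cast
      rw [hd, hd, hd, ← mul_add, ← map_add]
      simp
    exact_mod_cast this
  · by_contra h1
    have h2 := hd n
    have h3 : d n = 0 := hn
    rw [h3] at h2
    have := mul_pos (Nat.cast_pos.mpr hD : (0 : ℚ) < D) (hpos n h1)
    simp [← h2] at this
  · refine hfS hx hy ?_
    have h1 : d x = d y := hxy
    have h2 : (D : ℚ) * f (.ofMul x) = D * f (.ofMul y) := by rw [← hd, ← hd, h1]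
    exact mul_left_cancel₀ (by positivity) h2

end

/-! Families of polynomials whose pairwise products have coefficients in a subring -/

namespace Polynomial

theorem C_mul_mem_lifts {R S : Type*} [CommRing R] [CommRing S] {φ : R →+* S} {a : S} {p : S[X]}
    (ha : a ∈ Set.range φ) (hp : p ∈ lifts φ) : C a * p ∈ lifts φ := by
  obtain ⟨r, rfl⟩ := ha
  exact mul_mem (C_mem_lifts φ r) hp

/-! ### Integrality of the coefficients. -/

section Integral

variable {R S : Type*} [CommRing R] [CommRing S] [Algebra R S]

/-- Reversing a polynomial turns constant term `1` into leading coefficient `1`, and a monic factor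
of a monic polynomial over `R` has integral coefficients. -/
theorem isIntegral_coeff_of_mul_mem_lifts {u v : S[X]} (hu : u.coeff 0 = 1) (hv : v.coeff 0 = 1)
    (huv : u * v ∈ lifts (algebraMap R S)) (n : ℕ) : IsIntegral R (u.coeff n) := by
  have monic : ∀ w : S[X], w.coeff 0 = 1 → (reflect w.natDegree w).Monic := fun w hw => by
    refine monic_of_natDegree_le_of_coeff_eq_one w.natDegree ?_ ?_
    · rw [natDegree_le_iff_coeff_eq_zero]
      intro N hN
      rw [coeff_reflect, revAt_eq_self_of_lt hN, coeff_eq_zero_of_natDegree_lt hN]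
    · rw [coeff_reflect, revAt_le le_rfl, Nat.sub_self, hw]
  have hmul := reflect_mul u v (le_refl u.natDegree) (le_refl v.natDegree)
  have hlift : reflect u.natDegree u * reflect v.natDegree v ∈ lifts (algebraMap R S) := by
    rw [← hmul, lifts_iff_coeff_lifts]
    intro k
    rw [coeff_reflect]
    exact (lifts_iff_coeff_lifts _).mp huv _
  obtain ⟨q, hq, -, hqm⟩ := lifts_and_natDegree_eq_and_monic hlift ((monic u hu).mul (monic v hv))
  have hint := isIntegral_coeff_of_dvd q (reflect u.natDegree u) hqm (monic u hu)
    (by rw [hq]; exact Dvd.intro _ rfl)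
  by_cases hn : n ≤ u.natDegree
  · have := hint (u.natDegree - n)
    rwa [coeff_reflect, revAt_le (Nat.sub_le _ _), Nat.sub_sub_self hn] at this
  · rw [coeff_eq_zero_of_natDegree_lt (not_le.mp hn)]
    exact isIntegral_zero

theorem isIntegral_coeff_of_isIntegral_coeff_mul {f u : S[X]} (hu : u.coeff 0 = 1)
    (hu' : ∀ n, IsIntegral R (u.coeff n)) (hfu : ∀ n, IsIntegral R ((f * u).coeff n)) (n : ℕ) :
    IsIntegral R (f.coeff n) := by
  induction n using Nat.strong_induction_on with
  | _ n ih =>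
    have h := coeff_mul f u n
    rw [Finset.Nat.sum_antidiagonal_eq_sum_range_succ_mk, Finset.sum_range_succ, Nat.sub_self,
      hu, mul_one] at h
    rw [← sub_eq_iff_eq_add'] at h
    rw [← h]
    exact (hfu n).sub (IsIntegral.sum _ fun k hk => (ih k (Finset.mem_range.mp hk)).mul (hu' _))

theorem isIntegral_coeff_of_forall_mul_mem_lifts {ι : Type*} [Fintype ι] {f g : ι → S[X]}
    (hfg : ∀ i j, f i * g j ∈ lifts (algebraMap R S)) (h1 : ∑ i, f i * g i = 1)
    (hf : ∀ i, (f i).coeff 0 ∈ Set.range (algebraMap R S))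
    (hg : ∀ i, (g i).coeff 0 ∈ Set.range (algebraMap R S)) (i : ι) (n : ℕ) :
    IsIntegral R ((f i).coeff n) := by
  have h0 : ∑ i, (f i).coeff 0 * (g i).coeff 0 = 1 := by
    simpa [finsetSum_coeff, mul_coeff_zero] using congrArg (coeff · 0) h1
  -- `u` lies in the module generated by the `g j` and `v` in that generated by the `f j`, so `f i *
  -- u` and `u * v` have coefficients in `R`; both constant terms are `1`.
  let u := ∑ j, C ((f j).coeff 0) * g j
  let v := ∑ j, C ((g j).coeff 0) * f j
  have hu : u.coeff 0 = 1 := by simpa [u, finsetSum_coeff] using h0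
  have hv : v.coeff 0 = 1 := by simpa [v, finsetSum_coeff, mul_comm] using h0
  have hfu : ∀ i, f i * u ∈ lifts (algebraMap R S) := fun i => by
    rw [Finset.mul_sum]
    refine sum_mem fun j _ => ?_
    rw [mul_left_comm]
    exact C_mul_mem_lifts (hf j) (hfg i j)
  have huv : u * v ∈ lifts (algebraMap R S) := by
    rw [mul_comm, Finset.sum_mul]
    refine sum_mem fun j _ => ?_
    rw [mul_assoc]
    exact C_mul_mem_lifts (hg j) (hfu j)
  refine isIntegral_coeff_of_isIntegral_coeff_mul hu
    (isIntegral_coeff_of_mul_mem_lifts hu hv huv) (fun k => ?_) n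
  obtain ⟨r, hr⟩ := (lifts_iff_coeff_lifts _).mp (hfu i) k
  rw [← hr]
  exact isIntegral_algebraMap

end Integral

/-- Multiplication by a suitable `g j`, a nonzerodivisor, carries the `f i` to generators of an
ideal of `k[X]`. That ideal is principal, so each `f i` is a multiple over `k[X]` of a single `U`.
As `∑ i, f i * g i = 1`, `U` is a unit; `K` being reduced, it is constant, and the constant term of
`f j` shows that it comes from `k`. -/
theorem mem_lifts_of_forall_mul_mem_lifts_of_field {k K : Type*} [Field k] [CommRing K]
    [IsReduced K] (φ : k →+* K) {ι : Type*} [Fintype ι] {f g : ι → K[X]}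
    (hfg : ∀ i j, f i * g j ∈ lifts φ) (h1 : ∑ i, f i * g i = 1)
    (hf : ∀ i, (f i).coeff 0 ∈ Set.range φ) (hg : ∀ i, (g i).coeff 0 ∈ Set.range φ) (i : ι) :
    f i ∈ lifts φ := by
  rcases subsingleton_or_nontrivial K with hK | hK
  · exact ⟨0, Subsingleton.elim _ _⟩
  have h0 : ∑ i, (f i).coeff 0 * (g i).coeff 0 = 1 := by
    simpa [finsetSum_coeff, mul_coeff_zero] using congrArg (coeff · 0) h1
  obtain ⟨j, hj⟩ : ∃ j, (f j).coeff 0 * (g j).coeff 0 ≠ 0 := by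
    by_contra! h
    simp [h] at h0
  obtain ⟨α, hα⟩ := hf j
  obtain ⟨β, hβ⟩ := hg j
  have hβ0 : β ≠ 0 := fun h => hj (by rw [← hβ, h, map_zero, mul_zero])
  have hα0 : α ≠ 0 := fun h => hj (by rw [← hα, h, map_zero, zero_mul])
  choose P hP using fun i => hfg i j
  simp only [coe_mapRingHom] at hP
  obtain ⟨d, hd⟩ := IsPrincipalIdealRing.principal (Ideal.span (Set.range P))
  rw [Ideal.submodule_span_eq] at hd
  have hdP : ∀ i, ∃ e, P i = d * e := fun i => by
    have : P i ∈ Ideal.span (Set.range P) := Ideal.subset_span ⟨i, rfl⟩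
    rw [hd] at this
    exact Ideal.mem_span_singleton.mp this
  choose E hE using hdP
  obtain ⟨c, hc⟩ : ∃ c : ι → k[X], ∑ i, c i * P i = d := by
    have : d ∈ Ideal.span (Set.range P) := hd ▸ Ideal.mem_span_singleton_self d
    exact Ideal.mem_span_range_iff_exists_fun.mp this
  let U := ∑ i, (c i).map φ * f i
  have hU : d.map φ = U * g j := by
    rw [← hc, Polynomial.map_sum, Finset.sum_mul]
    refine Finset.sum_congr rfl fun i _ => ?_
    rw [Polynomial.map_mul, hP, mul_assoc]
  have hgj : g j ∈ nonZeroDivisors K[X] := by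
    refine mem_nonzeroDivisors_of_coeff_mem 0 ?_
    rw [← hβ]
    exact ((Ne.isUnit hβ0).map φ).mem_nonZeroDivisors
  have hfE : ∀ i, f i = (E i).map φ * U := fun i => by
    refine (mul_cancel_right_mem_nonZeroDivisors hgj).mp ?_
    rw [← hP, hE, Polynomial.map_mul, hU]
    ring
  have hUu : IsUnit U := by
    refine IsUnit.of_mul_eq_one (∑ i, (E i).map φ * g i) ?_
    rw [← h1, Finset.mul_sum]
    refine Finset.sum_congr rfl fun i _ => ?_
    rw [hfE i]
    ring
  have hUC : U = C (U.coeff 0) := by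
    ext n
    rw [coeff_C]
    split_ifs with hn
    · rw [hn]
    · exact ((isUnit_iff_coeff_isUnit_isNilpotent.mp hUu).2 n hn).eq_zero
  have hα' : φ ((E j).coeff 0) * U.coeff 0 = φ α := by
    rw [hα, hfE j, mul_coeff_zero, coeff_map]
  have hε : (E j).coeff 0 ≠ 0 := fun h => by
    rw [h, map_zero, zero_mul] at hα'
    exact hα0 ((map_eq_zero φ).mp hα'.symm)
  have hU0 : U.coeff 0 = φ (α / (E j).coeff 0) := by
    rw [div_eq_inv_mul, map_mul, ← hα', ← mul_assoc, ← map_mul, inv_mul_cancel₀ hε, map_one, one_mul]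
  rw [hfE, hUC, hU0]
  exact mul_mem ⟨E i, rfl⟩ (C_mem_lifts φ _)

end Polynomial

/-! Polynomials over subintegrally closed extensions -/

namespace Ideal

/-- The conductor of a ring extension: the largest ideal of the upper ring contained in the lower
ring. -/
def conductorOf (R S : Type*) [CommRing R] [CommRing S] [Algebra R S] : Ideal S where
  carrier := {s | ∀ y : S, s * y ∈ (⊥ : Subalgebra R S)}
  add_mem' ha hb y := by rw [add_mul]; exact add_mem (ha y) (hb y)
  zero_mem' y := by rw [zero_mul]; exact zero_mem _
  smul_mem' c x hx y := by rw [smul_eq_mul, mul_comm c, mul_assoc]; exact hx _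

variable {R S : Type*} [CommRing R] [CommRing S] [Algebra R S]

theorem conductorOf_le {s : S} (hs : s ∈ conductorOf R S) : s ∈ (⊥ : Subalgebra R S) := by
  simpa using hs 1

/-- If `x ^ 2` is in the conductor, the square and cube of every `x * y` lie in `R`, hence so does
`x * y`. -/
theorem isRadical_conductorOf
    (h : ∀ b : S, b ^ 2 ∈ (⊥ : Subalgebra R S) → b ^ 3 ∈ (⊥ : Subalgebra R S) →
      b ∈ (⊥ : Subalgebra R S)) : (conductorOf R S).IsRadical := by
  rw [isRadical_iff_pow_one_lt 2 one_lt_two]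
  intro x hx y
  refine h _ ?_ ?_
  · rw [mul_pow]
    exact hx _
  · rw [show (x * y) ^ 3 = x ^ 2 * (x * y ^ 3) by ring]
    exact hx _

/-- Every prime of `K` contracts to a prime that contains `I` and lies inside `p`, which is `p`
itself by minimality. When `K` is reduced, `ψ` therefore factors through the residue field of `p`.
-/
theorem isNilpotent_of_mem_minimalPrimes {K : Type*} [CommRing K] {I p : Ideal R}
    (hp : p ∈ I.minimalPrimes) (ψ : R →+* K) (hI : I ≤ RingHom.ker ψ)
    (hu : ∀ s ∉ p, IsUnit (ψ s)) {r : R} (hr : r ∈ p) : IsNilpotent (ψ r) := by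
  rw [nilpotent_iff_mem_prime]
  intro P hP
  refine hp.2 (y := P.comap ψ) ⟨inferInstance, fun x hx => ?_⟩ (fun x hx => ?_) hr
  · rw [mem_comap, RingHom.mem_ker.mp (hI hx)]
    exact zero_mem _
  · by_contra hxp
    exact hP.ne_top (eq_top_of_isUnit_mem _ hx (hu x hxp))

end Ideal

namespace Polynomial

open Ideal

variable {R S : Type*} [CommRing R] [CommRing S] [Algebra R S]

/-- At a minimal prime over the conductor, a pair of mutually inverse families of polynomials
becomes defined over the lower ring. -/
theorem exists_smul_coeff_mem_bot
    (h : ∀ b : S, b ^ 2 ∈ (⊥ : Subalgebra R S) → b ^ 3 ∈ (⊥ : Subalgebra R S) →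
      b ∈ (⊥ : Subalgebra R S))
    {p : Ideal R} (hp : p ∈ ((conductorOf R S).comap (algebraMap R S)).minimalPrimes)
    {ι : Type*} [Fintype ι] {f g : ι → S[X]}
    (hfg : ∀ i j, f i * g j ∈ lifts (algebraMap R S)) (h1 : ∑ i, f i * g i = 1)
    (hf : ∀ i, (f i).coeff 0 ∈ Set.range (algebraMap R S))
    (hg : ∀ i, (g i).coeff 0 ∈ Set.range (algebraMap R S)) (i : ι) (n : ℕ) :
    ∃ s ∉ p, s • (f i).coeff n ∈ (⊥ : Subalgebra R S) := by
  have hpp : p.IsPrime := hp.1.1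
  let c := conductorOf R S
  let W : Submonoid (S ⧸ c) := p.primeCompl.map ((Ideal.Quotient.mk c).comp (algebraMap R S))
  let K := Localization W
  have : IsReduced (S ⧸ c) :=
    (isRadical_iff_quotient_reduced c).mp (isRadical_conductorOf h)
  let Ψ : S →+* K := (algebraMap (S ⧸ c) K).comp (Ideal.Quotient.mk c)
  let ψ : R →+* K := Ψ.comp (algebraMap R S)
  have hψu : ∀ s ∉ p, IsUnit (ψ s) := fun s hs =>
    IsLocalization.map_units K (⟨_, s, hs, rfl⟩ : W)
  have hψ0 : ∀ r ∈ p, ψ r = 0 := fun r hr => by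
    refine (isNilpotent_of_mem_minimalPrimes hp ψ (fun x hx => ?_) hψu hr).eq_zero
    have : Ideal.Quotient.mk c (algebraMap R S x) = 0 := Ideal.Quotient.eq_zero_iff_mem.mpr hx
    simp [ψ, Ψ, this]
  let φ : p.ResidueField →+* K := Ideal.ResidueField.lift p ψ hψ0 hψu
  have hφ : φ.comp (algebraMap R p.ResidueField) = ψ := by
    ext r
    exact Ideal.ResidueField.lift_algebraMap p ψ hψ0 hψu r
  have hlift : ∀ q ∈ lifts (algebraMap R S), q.map Ψ ∈ lifts φ := by
    rintro _ ⟨q, rfl⟩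
    refine ⟨q.map (algebraMap R p.ResidueField), ?_⟩
    rw [coe_mapRingHom, coe_mapRingHom, map_map, map_map, hφ]
  have hrange : ∀ a ∈ Set.range (algebraMap R S), Ψ a ∈ Set.range φ := by
    rintro _ ⟨r, rfl⟩
    exact ⟨algebraMap R p.ResidueField r, DFunLike.congr_fun hφ r⟩
  have key := mem_lifts_of_forall_mul_mem_lifts_of_field φ
    (f := fun i => (f i).map Ψ) (g := fun i => (g i).map Ψ)
    (fun i j => by
      rw [← Polynomial.map_mul]
      exact hlift _ (hfg i j))
    (by simpa [Polynomial.map_sum] using congrArg (Polynomial.map Ψ) h1)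
    (fun i => by rw [coeff_map]; exact hrange _ (hf i))
    (fun i => by rw [coeff_map]; exact hrange _ (hg i)) i
  obtain ⟨κ, hκ⟩ := (lifts_iff_coeff_lifts _).mp key n
  rw [coeff_map] at hκ
  obtain ⟨r, s, hs, hrs⟩ : ∃ r s : R, s ∉ p ∧
      algebraMap R p.ResidueField s * κ = algebraMap R p.ResidueField r := by
    obtain ⟨x, y, hy, rfl⟩ := IsFractionRing.div_surjective (A := R ⧸ p) κ
    obtain ⟨x, rfl⟩ := Ideal.Quotient.mk_surjective x
    obtain ⟨y, rfl⟩ := Ideal.Quotient.mk_surjective y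
    have hy0 : Ideal.Quotient.mk p y ≠ 0 := nonZeroDivisors.ne_zero hy
    have hyp : y ∉ p := fun h => hy0 (Ideal.Quotient.eq_zero_iff_mem.mpr h)
    refine ⟨x, y, hyp, ?_⟩
    have : algebraMap R p.ResidueField y ≠ 0 := by simpa using hyp
    simp only [Ideal.algebraMap_quotient_residueField_mk]
    field_simp
  have hΨ : Ψ (algebraMap R S s * (f i).coeff n - algebraMap R S r) = 0 := by
    have h2 := congrArg φ hrs
    rw [map_mul, hκ, ← RingHom.comp_apply φ, ← RingHom.comp_apply φ, hφ] at h2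
    rw [map_sub, map_mul, sub_eq_zero]
    exact h2
  -- Vanishing in the localization means that some `t ∉ p` multiplies the difference into the
  -- conductor, hence into `R`.
  obtain ⟨⟨_, t, ht, rfl⟩, htw⟩ := (IsLocalization.map_eq_zero_iff W K _).mp hΨ
  change Ideal.Quotient.mk c (algebraMap R S t) * Ideal.Quotient.mk c _ = 0 at htw
  rw [← map_mul, Ideal.Quotient.eq_zero_iff_mem] at htw
  refine ⟨t * s, hpp.mul_notMem ht hs, ?_⟩
  have h3 := add_mem (conductorOf_le htw)
    (mul_mem (Subalgebra.algebraMap_mem ⊥ t) (Subalgebra.algebraMap_mem ⊥ r))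
  rw [← mul_add, sub_add_cancel, ← mul_assoc, ← map_mul, ← Algebra.smul_def] at h3
  exact h3

theorem mem_lifts_of_forall_mul_mem_lifts_of_finite [Module.Finite R S]
    (h : ∀ b : S, b ^ 2 ∈ (⊥ : Subalgebra R S) → b ^ 3 ∈ (⊥ : Subalgebra R S) →
      b ∈ (⊥ : Subalgebra R S))
    {ι : Type*} [Fintype ι] {f g : ι → S[X]}
    (hfg : ∀ i j, f i * g j ∈ lifts (algebraMap R S)) (h1 : ∑ i, f i * g i = 1)
    (hf : ∀ i, (f i).coeff 0 ∈ Set.range (algebraMap R S))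
    (hg : ∀ i, (g i).coeff 0 ∈ Set.range (algebraMap R S))
    (htop : Algebra.adjoin R {a | ∃ i n, a = (f i).coeff n ∨ a = (g i).coeff n} = ⊤) :
    (⊤ : Subalgebra R S) = ⊥ := by
  by_cases hc : conductorOf R S = ⊤
  · exact eq_bot_iff.mpr fun x _ => conductorOf_le (hc ▸ Submodule.mem_top)
  exfalso
  have hI : (conductorOf R S).comap (algebraMap R S) ≠ ⊤ := comap_ne_top _ hc
  obtain ⟨p, hp⟩ := Ideal.nonempty_minimalPrimes hI
  have hpp : p.IsPrime := hp.1.1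
  -- `Q` consists of the elements that become elements of `R` locally at `p`. It contains the
  -- generating coefficients; as `S` is finite over `R`, a product of the denominators of module
  -- generators lies in the conductor but not in `p`.
  let Q : Subalgebra R S :=
    { carrier := {y | ∃ s ∉ p, s • y ∈ (⊥ : Subalgebra R S)}
      mul_mem' := by
        rintro x y ⟨s, hs, hsx⟩ ⟨t, ht, hty⟩
        refine ⟨s * t, hpp.mul_notMem hs ht, ?_⟩
        rw [← smul_mul_smul_comm]
        exact mul_mem hsx hty
      add_mem' := by
        rintro x y ⟨s, hs, hsx⟩ ⟨t, ht, hty⟩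
        refine ⟨s * t, hpp.mul_notMem hs ht, ?_⟩
        rw [smul_add, mul_comm, mul_smul, mul_comm, mul_smul]
        exact add_mem (Subalgebra.smul_mem _ hsx _) (Subalgebra.smul_mem _ hty _)
      algebraMap_mem' := fun r => ⟨1, hpp.one_notMem, by
        rw [one_smul]; exact Subalgebra.algebraMap_mem _ _⟩ }
  have hQ : Q = ⊤ := by
    rw [eq_top_iff, ← htop, Algebra.adjoin_le_iff]
    rintro a ⟨i, n, rfl | rfl⟩
    · exact exists_smul_coeff_mem_bot h hp hfg h1 hf hg i n
    · exact exists_smul_coeff_mem_bot h hp (f := g) (g := f)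
        (fun i j => by rw [mul_comm]; exact hfg j i) (by simpa only [mul_comm] using h1) hg hf i n
  obtain ⟨T, hT⟩ := Module.Finite.fg_top (R := R) (M := S)
  have hall : ∀ y : S, ∃ s ∉ p, s • y ∈ (⊥ : Subalgebra R S) := fun y =>
    (hQ ▸ Algebra.mem_top : y ∈ Q)
  choose s hs hsy using hall
  have hmem : algebraMap R S (∏ t ∈ T, s t) ∈ conductorOf R S := by
    intro y
    have hy : y ∈ Submodule.span R (T : Set S) := hT ▸ Submodule.mem_top
    rw [← Algebra.smul_def]
    induction hy using Submodule.span_induction with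
    | mem t ht =>
      classical
      rw [← Finset.prod_erase_mul T s ht, mul_smul]
      exact Subalgebra.smul_mem _ (hsy t) _
    | zero => rw [smul_zero]; exact zero_mem _
    | add x y _ _ hx hy => rw [smul_add]; exact add_mem hx hy
    | smul r x _ hx => rw [smul_comm]; exact Subalgebra.smul_mem _ hx _
  obtain ⟨t, -, ht⟩ := (hpp.prod_mem_iff).mp (hp.1.2 hmem)
  exact hs t ht

/-- Let `R` be subintegrally closed in `S`, and let `I` be an invertible `R[X]`-submodule of `S[X]`
whose reduction modulo `X` is `R`. Then `I` is contained in `R[X]`. -/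
theorem mem_lifts_of_forall_mul_mem_lifts  (h : ∀ b : S, b ^ 2 ∈ (⊥ : Subalgebra R S) → b ^ 3 ∈ (⊥ : Subalgebra R S) →
      b ∈ (⊥ : Subalgebra R S))
    {ι : Type*} [Fintype ι] {f g : ι → S[X]}
    (hfg : ∀ i j, f i * g j ∈ lifts (algebraMap R S)) (h1 : ∑ i, f i * g i = 1)
    (hf : ∀ i, (f i).coeff 0 ∈ Set.range (algebraMap R S))
    (hg : ∀ i, (g i).coeff 0 ∈ Set.range (algebraMap R S)) (i : ι) :
    f i ∈ lifts (algebraMap R S) := by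
  let T : Set S := {a | ∃ i n, a = (f i).coeff n ∨ a = (g i).coeff n}
  have hTint : ∀ a ∈ T, IsIntegral R a := by
    rintro a ⟨i, n, rfl | rfl⟩
    · exact isIntegral_coeff_of_forall_mul_mem_lifts hfg h1 hf hg i n
    · exact isIntegral_coeff_of_forall_mul_mem_lifts (f := g) (g := f)
        (fun i j => by rw [mul_comm]; exact hfg j i) (by simpa only [mul_comm] using h1) hg hf i n
  have hTfin : T.Finite := by
    classical
    refine ((Finset.univ.biUnion fun i => (f i).support.image (f i).coeff ∪
      (g i).support.image (g i).coeff) ∪ {0}).finite_toSet.subset ?_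
    rintro a ⟨i, n, h⟩
    by_cases ha : a = 0
    · simp [ha]
    · simp only [Finset.coe_union, Set.mem_union, Finset.mem_coe, Finset.mem_biUnion,
        Finset.mem_univ, true_and, Finset.mem_union, Finset.mem_image, mem_support_iff]
      rcases h with rfl | rfl
      · exact Or.inl ⟨i, Or.inl ⟨n, ha, rfl⟩⟩
      · exact Or.inl ⟨i, Or.inr ⟨n, ha, rfl⟩⟩
  -- Finitely many integral elements generate a finite extension, in which `R` is still
  -- subintegrally closed.
  let R' := Algebra.adjoin R T
  have hfin : Module.Finite R R' := Module.Finite.of_fg (fg_adjoin_of_finite hTfin hTint)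
  have hval : Function.Injective (R'.val : R' →+* S) := Subtype.val_injective
  have hcomp : (R'.val : R' →+* S).comp (algebraMap R R') = algebraMap R S := rfl
  have hbot : ∀ x : R', x ∈ (⊥ : Subalgebra R R') ↔ (x : S) ∈ (⊥ : Subalgebra R S) := fun x => by
    rw [Algebra.mem_bot, Algebra.mem_bot]
    exact exists_congr fun r => ⟨fun hr => congrArg Subtype.val hr, fun hr => Subtype.ext hr⟩
  have hf' : ∀ i, ∃ q : R'[X], q.map (R'.val : R' →+* S) = f i := fun i =>
    (lifts_iff_coeff_lifts _).mpr fun n =>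
      ⟨⟨(f i).coeff n, Algebra.subset_adjoin ⟨i, n, Or.inl rfl⟩⟩, rfl⟩
  have hg' : ∀ i, ∃ q : R'[X], q.map (R'.val : R' →+* S) = g i := fun i =>
    (lifts_iff_coeff_lifts _).mpr fun n =>
      ⟨⟨(g i).coeff n, Algebra.subset_adjoin ⟨i, n, Or.inr rfl⟩⟩, rfl⟩
  choose F hF using hf'
  choose G hG using hg'
  have hFc : ∀ i n, ((F i).coeff n : S) = (f i).coeff n := fun i n => by
    rw [← hF i, coeff_map]; rfl
  have hGc : ∀ i n, ((G i).coeff n : S) = (g i).coeff n := fun i n => by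
    rw [← hG i, coeff_map]; rfl
  have htop : Algebra.adjoin R {a : R' | ∃ i n, a = (F i).coeff n ∨ a = (G i).coeff n} = ⊤ := by
    rw [← Algebra.adjoin_adjoin_coe_preimage (s := T)]
    congr 1
    ext a
    simp only [Set.mem_preimage, T, Set.mem_ofPred_eq, ← hFc, ← hGc, SetLike.coe_eq_coe]
  have key := mem_lifts_of_forall_mul_mem_lifts_of_finite (R := R) (S := R')
    (fun b hb2 hb3 => (hbot b).mpr (h _ ((hbot _).mp hb2) ((hbot _).mp hb3)))
    (f := F) (g := G)
    (fun i j => by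
      obtain ⟨P, hP⟩ := hfg i j
      refine ⟨P, map_injective _ hval ?_⟩
      rw [coe_mapRingHom] at hP ⊢
      rw [map_map, hcomp, hP, Polynomial.map_mul, hF, hG])
    (map_injective _ hval (by
      rw [Polynomial.map_sum, Polynomial.map_one, ← h1]
      simp only [Polynomial.map_mul, hF, hG]))
    (fun i => by
      have := (hbot ((F i).coeff 0)).mpr (by rw [hFc]; exact Algebra.mem_bot.mpr (hf i))
      exact Algebra.mem_bot.mp this)
    (fun i => by
      have := (hbot ((G i).coeff 0)).mpr (by rw [hGc]; exact Algebra.mem_bot.mpr (hg i))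
      exact Algebra.mem_bot.mp this) htop
  rw [lifts_iff_coeff_lifts]
  intro n
  have : (F i).coeff n ∈ (⊥ : Subalgebra R R') := key ▸ Algebra.mem_top
  rw [hbot, hFc] at this
  exact Algebra.mem_bot.mp this

end Polynomial

/-! Elementwise characterizations of subintegral closedness -/

theorem Subring.isSubintegrallyClosed_iff {B : Type*} [CommRing B] {A : Subring B} :
    A.IsSubintegrallyClosed ↔ ∀ b : B, b ^ 2 ∈ A → b ^ 3 ∈ A → b ∈ A := by
  constructor
  · intro h b h2 h3
    have hD : A.IsSubintegral (Subring.closure (insert b (A : Set B))) :=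
      ⟨{Subring.closure (insert b (A : Set B))}, by
        rintro _ rfl
        exact Relation.ReflTransGen.single ⟨b, h2, h3, rfl⟩, by simp⟩
    have hle : Subring.closure (insert b (A : Set B)) ≤ A.subintegralClosure := le_sSup hD
    rw [h] at hle
    exact hle (Subring.subset_closure (Set.mem_insert _ _))
  · intro h
    refine le_antisymm (sSup_le ?_) (le_sSup ⟨{A}, by
      rintro _ rfl
      exact Relation.ReflTransGen.refl, by simp⟩)
    rintro C ⟨S, hS, hC⟩ x hx
    have hx' : x ∈ (C : Set B) := hx
    rw [hC] at hx'
    obtain ⟨D, hD, hxD⟩ := Set.mem_iUnion₂.mp hx'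
    suffices D = A from this ▸ hxD
    clear hxD hx' hx x hC
    replace hD := hS D hD
    induction hD with
    | refl => rfl
    | tail _ hE ih =>
      obtain ⟨b, h2, h3, rfl⟩ := hE
      subst ih
      rw [Set.insert_eq_of_mem (show b ∈ _ from h b h2 h3), Subring.closure_eq]

theorem Submonoid.IsSubintegrallyClosed.mem {N : Type*} [CommMonoid N] {M : Submonoid N}
    (h : M.IsSubintegrallyClosed) {x : N} (h2 : x ^ 2 ∈ M) (h3 : x ^ 3 ∈ M) : x ∈ M := by
  let D : Submonoid N :=
    { carrier := (M : Set N) ∪ (fun c => x * c) '' (M : Set N)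
      one_mem' := Or.inl M.one_mem
      mul_mem' := by
        rintro _ _ (ha | ⟨a, ha, rfl⟩) (hb | ⟨b, hb, rfl⟩)
        · exact Or.inl (M.mul_mem ha hb)
        · exact Or.inr ⟨_, M.mul_mem ha hb, mul_left_comm _ _ _⟩
        · exact Or.inr ⟨_, M.mul_mem ha hb, (mul_assoc _ _ _).symm⟩
        · refine Or.inl ?_
          have := M.mul_mem h2 (M.mul_mem ha hb)
          rwa [sq, mul_mul_mul_comm] at this }
  have hD : M.IsSubintegral D := ⟨{D}, by
    rintro _ rfl
    exact Relation.ReflTransGen.single ⟨x, h2, h3, rfl⟩, by simp⟩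
  have hle : D ≤ M.subintegralClosure := le_sSup hD
  rw [h] at hle
  exact hle (Or.inr ⟨1, M.one_mem, mul_one x⟩)

/-- If `x` is such that `x ^ 2` and `x ^ 3` lie in `R`, then the submodules generated by
`1 - x, x ^ 2` and by `(1 + x) * (1 + x ^ 2), x ^ 2` are inverse to each other. -/
theorem Subring.mul_mem_and_sum_eq_one {S : Type*} [CommRing S] (R : Subring S) {x : S}
    (h2 : x ^ 2 ∈ R) (h3 : x ^ 3 ∈ R) :
    (∀ i j : Fin 2, (![1 - x, x ^ 2] : Fin 2 → S) i *
      (![(1 + x) * (1 + x ^ 2), x ^ 2] : Fin 2 → S) j ∈ R) ∧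
    ∑ i, (![1 - x, x ^ 2] : Fin 2 → S) i * (![(1 + x) * (1 + x ^ 2), x ^ 2] : Fin 2 → S) i = 1 := by
  constructor
  · rw [Fin.forall_fin_two]
    simp only [Fin.forall_fin_two, Matrix.cons_val_zero, Matrix.cons_val_one]
    refine ⟨⟨?_, ?_⟩, ?_, ?_⟩
    · rw [show (1 - x) * ((1 + x) * (1 + x ^ 2)) = 1 - x ^ 2 * x ^ 2 by ring]
      exact sub_mem (one_mem _) (mul_mem h2 h2)
    · rw [show (1 - x) * x ^ 2 = x ^ 2 - x ^ 3 by ring]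
      exact sub_mem h2 h3
    · rw [show x ^ 2 * ((1 + x) * (1 + x ^ 2)) = (x ^ 2 + x ^ 3) * (1 + x ^ 2) by ring]
      exact mul_mem (add_mem h2 h3) (add_mem (one_mem _) h2)
    · exact mul_mem h2 h2
  · simp only [Fin.sum_univ_two, Matrix.cons_val_zero, Matrix.cons_val_one]
    ring

namespace Polynomial

theorem mem_lifts_subtype {S : Type*} [CommRing S] {R : Subring S} {p : S[X]} :
    p ∈ lifts (algebraMap R S) ↔ ∀ n, p.coeff n ∈ R := by
  rw [lifts_iff_coeff_lifts]
  exact forall_congr' fun n => ⟨fun ⟨r, hr⟩ => hr ▸ r.2, fun h => ⟨⟨_, h⟩, rfl⟩⟩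

theorem coeff_mem_of_forall_mul_coeff_mem {S : Type*} [CommRing S] {R : Subring S}
    (h : ∀ b : S, b ^ 2 ∈ R → b ^ 3 ∈ R → b ∈ R) {ι : Type*} [Fintype ι] {f g : ι → S[X]}
    (hfg : ∀ i j n, (f i * g j).coeff n ∈ R) (h1 : ∑ i, f i * g i = 1)
    (hf : ∀ i, (f i).coeff 0 ∈ R) (hg : ∀ i, (g i).coeff 0 ∈ R) (i : ι) (n : ℕ) :
    (f i).coeff n ∈ R := by
  have hbot : ∀ b : S, b ∈ (⊥ : Subalgebra R S) ↔ b ∈ R := fun b => by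
    rw [Algebra.mem_bot]
    exact ⟨fun ⟨r, hr⟩ => hr ▸ r.2, fun h => ⟨⟨_, h⟩, rfl⟩⟩
  refine mem_lifts_subtype.mp (mem_lifts_of_forall_mul_mem_lifts (R := R) ?_
    (fun i j => mem_lifts_subtype.mpr (hfg i j)) h1
    (fun i => ⟨⟨_, hf i⟩, rfl⟩) (fun i => ⟨⟨_, hg i⟩, rfl⟩) i) n
  simpa only [hbot] using h

/-- The families of `Subring.mul_mem_and_sum_eq_one` have products in `A[X]`, and their constant
terms lie in `A` because `x.coeff 0` does. The previous theorem then puts `1 - x` in `A[X]`. -/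
theorem coeff_mem_of_sq_of_cube {B : Type*} [CommRing B] {A : Subring B}
    (h : ∀ b : B, b ^ 2 ∈ A → b ^ 3 ∈ A → b ∈ A) {x : B[X]}
    (h2 : ∀ n, (x ^ 2).coeff n ∈ A) (h3 : ∀ n, (x ^ 3).coeff n ∈ A) (n : ℕ) :
    x.coeff n ∈ A := by
  let R : Subring B[X] := (mapRingHom A.subtype).range
  have hR : ∀ p : B[X], p ∈ R ↔ ∀ n, p.coeff n ∈ A := fun p => mem_lifts_subtype (R := A)
  obtain ⟨hfg, h1⟩ := R.mul_mem_and_sum_eq_one ((hR _).mpr h2) ((hR _).mpr h3)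
  have h0 : x.coeff 0 ∈ A := h _
    (by simpa only [coeff_zero_eq_eval_zero, eval_pow] using h2 0)
    (by simpa only [coeff_zero_eq_eval_zero, eval_pow] using h3 0)
  have h02 : (x ^ 2).coeff 0 ∈ A := h2 0
  have key := coeff_mem_of_forall_mul_coeff_mem h (fun i j => (hR _).mp (hfg i j)) h1
    (by
      rw [Fin.forall_fin_two]
      refine ⟨?_, h02⟩
      simpa using sub_mem (one_mem A) h0)
    (by
      rw [Fin.forall_fin_two]
      refine ⟨?_, h02⟩
      simp only [Matrix.cons_val_zero, mul_coeff_zero, coeff_add, coeff_one_zero]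
      exact mul_mem (add_mem (one_mem A) h0) (add_mem (one_mem A) h02)) 0
  have hx : x = 1 - (1 - x) := by ring
  rw [hx, coeff_sub]
  refine sub_mem ?_ (key n)
  rw [coeff_one]
  split_ifs
  · exact one_mem _
  · exact zero_mem _

end Polynomial

/-! Monoid algebras -/

instance Submonoid.isMulTorsionFree {N : Type*} [CommMonoid N] [IsMulTorsionFree N]
    (M : Submonoid N) : IsMulTorsionFree M :=
  Function.Injective.isMulTorsionFree M.subtype Subtype.val_injective

theorem Submonoid.subsingleton_units {N : Type*} [CommMonoid N] [Subsingleton Nˣ]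
    (M : Submonoid N) : Subsingleton Mˣ :=
  ⟨fun a b => Units.ext (Subtype.ext (congrArg Units.val
    (Subsingleton.elim (Units.map M.subtype a) (Units.map M.subtype b))))⟩

theorem Submonoid.fg_closure_finset {N : Type*} [CommMonoid N] (S : Finset N) :
    Monoid.FG (Submonoid.closure (S : Set N)) :=
  (Monoid.fg_iff_submonoid_fg _).mpr ⟨S, rfl⟩

namespace MonoidAlgebra

variable {B N : Type*} [CommRing B] [CommMonoid N]

theorem exists_mul_eq_of_coeff_mul_ne_zero {x y : MonoidAlgebra B N} {n : N}
    (h : (x * y).coeff n ≠ 0) : ∃ u v, x.coeff u ≠ 0 ∧ y.coeff v ≠ 0 ∧ u * v = n := by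
  classical
  obtain ⟨u, hu, v, hv, huv⟩ := Finset.mem_mul.mp
    (support_coeff_mul_subset x y (Finsupp.mem_support_iff.mpr h))
  exact ⟨u, v, Finsupp.mem_support_iff.mp hu, Finsupp.mem_support_iff.mp hv, huv⟩

theorem mem_subringMonoidAlgebra {A : Subring B} {M : Submonoid N} {x : MonoidAlgebra B N} :
    x ∈ A.monoidAlgebra M ↔ (∀ n, x.coeff n ∈ A) ∧ ∀ n, x.coeff n ≠ 0 → n ∈ M := by
  classical
  constructor
  · rintro ⟨y, rfl⟩
    induction y using MonoidAlgebra.induction_linear with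
    | zero => simp
    | add y z hy hz =>
      rw [map_add]
      refine ⟨fun n => add_mem (hy.1 n) (hz.1 n), fun n hn => ?_⟩
      by_contra hM
      have h1 := not_not.mp (mt (hy.2 n) hM)
      have h2 := not_not.mp (mt (hz.2 n) hM)
      rw [coeff_add, Finsupp.add_apply, h1, h2, add_zero] at hn
      exact hn rfl
    | single m a =>
      have : ((mapDomainRingHom B M.subtype).comp (mapRingHom M A.subtype)) (single m a) =
          single (m : N) (a : B) := by simp [mapDomainRingHom]
      rw [this]
      refine ⟨fun n => ?_, fun n => ?_⟩
      · rw [coeff_single, Finsupp.single_apply]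
        split_ifs
        · exact a.2
        · exact zero_mem _
      · rw [coeff_single, Finsupp.single_apply]
        split_ifs with h
        · exact fun _ => h ▸ m.2
        · exact fun h => (h rfl).elim
  · rintro ⟨hA, hM⟩
    rw [← sum_coeff_single x]
    refine sum_mem fun n hn => ?_
    have hn' := Finsupp.mem_support_iff.mp hn
    refine ⟨single ⟨n, hM n hn'⟩ ⟨x.coeff n, hA n⟩, ?_⟩
    simp [mapDomainRingHom]

theorem coeff_mapDomainRingHom_subtype {N' : Submonoid N} (y : MonoidAlgebra B N') (n : N') :
    (mapDomainRingHom B N'.subtype y).coeff n = y.coeff n := by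
  change (Finsupp.mapDomain N'.subtype y.coeff) (N'.subtype n) = _
  exact Finsupp.mapDomain_apply Subtype.val_injective _ _

theorem exists_mapDomainRingHom_eq {N' : Submonoid N} {x : MonoidAlgebra B N}
    (h : ∀ n, x.coeff n ≠ 0 → n ∈ N') : ∃ y, mapDomainRingHom B N'.subtype y = x :=
  ⟨comapDomain N'.subtype Subtype.val_injective x, mapDomain_comapDomain (fun n hn =>
    ⟨⟨n, h n (Finsupp.mem_support_iff.mp hn)⟩, rfl⟩) _⟩

open Polynomial in
/-- The substitution of `X ^ d n` for `n`. -/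
noncomputable def toPolynomial (B : Type*) [CommRing B] (d : Additive N →+ ℕ) :
    MonoidAlgebra B N →+* B[X] :=
  (MonoidAlgebra.lift B B[X] N
    ⟨⟨fun n => X ^ d (.ofMul n), by simp⟩, fun a b => by simp [pow_add]⟩).toRingHom

theorem toPolynomial_apply (d : Additive N →+ ℕ) (x : MonoidAlgebra B N) :
    toPolynomial B d x = x.coeff.sum fun n b => b • Polynomial.X ^ d (.ofMul n) :=
  MonoidAlgebra.lift_apply _ _

theorem coeff_toPolynomial (d : Additive N →+ ℕ) (x : MonoidAlgebra B N) (k : ℕ) :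
    (toPolynomial B d x).coeff k =
      ∑ n ∈ x.coeff.support, if k = d (.ofMul n) then x.coeff n else 0 := by
  rw [toPolynomial_apply, Finsupp.sum, Polynomial.finsetSum_coeff]
  simp [Polynomial.coeff_X_pow]

theorem coeff_toPolynomial_mem {A : Subring B} (d : Additive N →+ ℕ) {x : MonoidAlgebra B N}
    (h : ∀ n, x.coeff n ∈ A) (k : ℕ) : (toPolynomial B d x).coeff k ∈ A := by
  rw [coeff_toPolynomial]
  refine sum_mem fun n _ => ?_
  split_ifs
  · exact h n
  · exact zero_mem _

theorem coeff_toPolynomial_of_injOn {d : Additive N →+ ℕ} {x : MonoidAlgebra B N}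
    (hd : Set.InjOn (fun n => d (.ofMul n)) x.coeff.support) {n : N} (hn : x.coeff n ≠ 0) :
    (toPolynomial B d x).coeff (d (.ofMul n)) = x.coeff n := by
  rw [coeff_toPolynomial, Finset.sum_eq_single n]
  · simp
  · intro m hm hmn
    rw [if_neg]
    exact fun h => hmn (hd hm (Finsupp.mem_support_iff.mpr hn) h.symm)
  · intro h
    simpa using h

/-! ### Coefficients: reduction to polynomials. -/

section CoefficientRing

variable [IsCancelMul N] [IsMulTorsionFree N] [Subsingleton Nˣ]

/-- If `A` is subintegrally closed in `B`, then `A[N]` is subintegrally closed in `B[N]`. -/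
theorem coeff_mem_of_sq_of_cube {A : Subring B} (h : ∀ b : B, b ^ 2 ∈ A → b ^ 3 ∈ A → b ∈ A)
    {x : MonoidAlgebra B N} (h2 : ∀ n, (x ^ 2).coeff n ∈ A) (h3 : ∀ n, (x ^ 3).coeff n ∈ A)
    (n : N) : x.coeff n ∈ A := by
  let N' := Submonoid.closure (x.coeff.support : Set N)
  have := N'.subsingleton_units
  have : Monoid.FG N' := Submonoid.fg_closure_finset _
  obtain ⟨y, hy⟩ := exists_mapDomainRingHom_eq (N' := N') (x := x)
    fun n hn => Submonoid.subset_closure (Finsupp.mem_support_iff.mpr hn)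
  by_cases hn : x.coeff n = 0
  · rw [hn]; exact zero_mem _
  have hnN : n ∈ N' := Submonoid.subset_closure (Finsupp.mem_support_iff.mpr hn)
  have hyn : y.coeff ⟨n, hnN⟩ = x.coeff n := by
    rw [← coeff_mapDomainRingHom_subtype, hy]
  -- A degree injective on the support makes each coefficient of `y` a coefficient of its image in
  -- `B[X]`.
  obtain ⟨d, -, hd⟩ := exists_hom_nat_pos y.coeff.support
  rw [← hyn, ← coeff_toPolynomial_of_injOn hd (by rwa [hyn])]
  refine Polynomial.coeff_mem_of_sq_of_cube h (fun k => ?_) (fun k => ?_) _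
  · rw [← map_pow]
    refine coeff_toPolynomial_mem d (fun m => ?_) k
    rw [← coeff_mapDomainRingHom_subtype, map_pow, hy]
    exact h2 m
  · rw [← map_pow]
    refine coeff_toPolynomial_mem d (fun m => ?_) k
    rw [← coeff_mapDomainRingHom_subtype, map_pow, hy]
    exact h3 m

end CoefficientRing

end MonoidAlgebra

/-! Supports of elements of monoid algebras whose square and cube are supported in a submonoid -/

/-- All exponents from `k * k` on are sums of copies of `k` and `k + 1`. The bound then descends to
`1`: for `K ≥ 1`, the square and cube of `n ^ K` have exponents above `K`. -/
theorem Submonoid.mem_of_pow_mem_of_pow_succ_mem {N : Type*} [CommMonoid N] {P : Submonoid N}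
    (h : ∀ n : N, n ^ 2 ∈ P → n ^ 3 ∈ P → n ∈ P) {n : N} {k : ℕ} (h0 : n ^ k ∈ P)
    (h1 : n ^ (k + 1) ∈ P) : n ∈ P := by
  have large : ∀ K : ℕ, (∀ j ≥ K, n ^ j ∈ P) → n ∈ P := by
    intro K
    induction K with
    | zero => exact fun hK => by simpa using hK 1 (Nat.zero_le _)
    | succ K ih =>
      intro hK
      refine ih fun j hj => ?_
      rcases Nat.eq_or_lt_of_le hj with rfl | hj
      · rcases Nat.eq_zero_or_pos K with rfl | hK0
        · rw [pow_zero]; exact P.one_mem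
        · refine h _ ?_ ?_
          · rw [← pow_mul]
            exact hK _ (by omega)
          · rw [← pow_mul]
            exact hK _ (by omega)
      · exact hK j hj
  rcases Nat.eq_zero_or_pos k with rfl | hk
  · simpa using h1
  refine large (k * k) fun j hj => ?_
  have hr : j % k < k := Nat.mod_lt _ hk
  have hq : k ≤ j / k := (Nat.le_div_iff_mul_le hk).mpr hj
  have hj' : j = k * (j / k - j % k) + (k + 1) * (j % k) := by
    obtain ⟨e, he⟩ := Nat.exists_eq_add_of_le (hr.le.trans hq)
    have := Nat.div_add_mod j k
    rw [he, Nat.add_sub_cancel_left]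
    rw [he] at this
    nlinarith
  rw [hj', pow_add, pow_mul, pow_mul]
  exact P.mul_mem (P.pow_mem h0 _) (P.pow_mem h1 _)

/-- The submonoid of elements having a positive power in a given submonoid. -/
def Submonoid.rootClosure {N : Type*} [CommMonoid N] (P : Submonoid N) : Submonoid N where
  carrier := {n | ∃ d : ℕ, 0 < d ∧ n ^ d ∈ P}
  one_mem' := ⟨1, one_pos, by rw [one_pow]; exact P.one_mem⟩
  mul_mem' := by
    rintro a b ⟨d, hd, ha⟩ ⟨e, he, hb⟩
    refine ⟨d * e, Nat.mul_pos hd he, ?_⟩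
    rw [mul_pow, pow_mul, mul_comm d e, pow_mul]
    exact P.mul_mem (P.pow_mem ha _) (P.pow_mem hb _)

theorem Submonoid.mem_rootClosure_of_pow_mem {N : Type*} [CommMonoid N] {P : Submonoid N} {n : N}
    {d : ℕ} (hd : 0 < d) (h : n ^ d ∈ P.rootClosure) : n ∈ P.rootClosure := by
  obtain ⟨e, he, h⟩ := h
  exact ⟨d * e, Nat.mul_pos hd he, by rwa [pow_mul]⟩

/-- The face of a commutative monoid generated by an element: the submonoid of divisors of its
powers. -/
def divisorsOfPowers {N : Type*} [CommMonoid N] (n : N) : Submonoid N where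
  carrier := {m | ∃ j : ℕ, m ∣ n ^ j}
  one_mem' := ⟨0, one_dvd _⟩
  mul_mem' := by
    rintro a b ⟨i, hi⟩ ⟨j, hj⟩
    exact ⟨i + j, by rw [pow_add]; exact mul_dvd_mul hi hj⟩

theorem mul_mem_divisorsOfPowers_iff {N : Type*} [CommMonoid N] {n a b : N} :
    a * b ∈ divisorsOfPowers n ↔ a ∈ divisorsOfPowers n ∧ b ∈ divisorsOfPowers n :=
  ⟨fun ⟨j, hj⟩ => ⟨⟨j, (Dvd.intro _ rfl).trans hj⟩, ⟨j, (Dvd.intro_left _ rfl).trans hj⟩⟩,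
    fun h => mul_mem h.1 h.2⟩

theorem self_mem_divisorsOfPowers {N : Type*} [CommMonoid N] (n : N) : n ∈ divisorsOfPowers n :=
  ⟨1, by rw [pow_one]⟩

namespace MonoidAlgebra

open Classical in
/-- The projection of a monoid algebra onto the monoid algebra of a face. -/
noncomputable def faceProjection (B : Type*) [CommRing B] {N : Type*} [CommMonoid N]
    (T : Submonoid N) (hT : ∀ a b, a * b ∈ T ↔ a ∈ T ∧ b ∈ T) :
    MonoidAlgebra B N →+* MonoidAlgebra B N :=
  (MonoidAlgebra.lift B (MonoidAlgebra B N) N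
    ⟨⟨fun n => if n ∈ T then single n 1 else 0, by simp [one_def]⟩, fun a b => by
      by_cases ha : a ∈ T <;> by_cases hb : b ∈ T <;> simp [hT, ha, hb, single_mul_single]⟩).toRingHom

open Classical in
theorem coeff_faceProjection {B N : Type*} [CommRing B] [CommMonoid N]
    (T : Submonoid N) (hT : ∀ a b, a * b ∈ T ↔ a ∈ T ∧ b ∈ T) (x : MonoidAlgebra B N) (n : N) :
    (faceProjection B T hT x).coeff n = if n ∈ T then x.coeff n else 0 := by
  have : faceProjection B T hT x = x.coeff.sum fun m b => b • if m ∈ T then single m 1 else 0 :=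
    MonoidAlgebra.lift_apply _ _
  rw [this]
  induction x using MonoidAlgebra.induction_linear with
  | zero => simp
  | add x y hx hy =>
    rw [coeff_add, Finsupp.sum_add_index (by simp) (by intros; rw [add_smul]), coeff_add,
      Finsupp.add_apply, hx (MonoidAlgebra.lift_apply _ _), hy (MonoidAlgebra.lift_apply _ _)]
    split_ifs <;> simp
  | single m b =>
    rw [coeff_single, Finsupp.sum_single_index (by simp)]
    by_cases hm : m ∈ T
    · by_cases hn : n ∈ T
      · simp [hm, hn]
      · have : m ≠ n := fun h => hn (h ▸ hm)
        simp [hm, hn, this]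
    · by_cases hn : n ∈ T
      · have : m ≠ n := fun h => hm (h ▸ hn)
        simp [hm, hn, this]
      · simp [hm, hn]

/-! ### Supports over a domain: roots, group of fractions, faces. -/

section Support

variable {D N : Type*} [CommRing D] [IsDomain D] [CommMonoid N] [IsCancelMul N]
  [IsMulTorsionFree N]

theorem mem_rootClosure_of_coeff_ne_zero {P : Submonoid N} {x : MonoidAlgebra D N}
    (h2 : ∀ n, (x ^ 2).coeff n ≠ 0 → n ∈ P) {n : N} (hn : x.coeff n ≠ 0) :
    n ∈ P.rootClosure := by
  classical
  by_contra hnP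
  -- No positive power of `n` is a product of support elements in the root closure, so some `f` is
  -- larger at `n` than at all of these. The maximum of `f` on the support is attained at a single
  -- `v`; then `v ^ 2` survives in `x ^ 2`, so `v` is in the root closure although `f v ≥ f n`.
  obtain ⟨f, hf, hfinj⟩ := exists_hom_rat_lt
    (x.coeff.support.filter (· ∈ P.rootClosure)) (fun _ => n) id (fun c hc => by
      by_contra! h0
      obtain ⟨i, hi, hci⟩ := h0
      refine hnP (Submonoid.mem_rootClosure_of_pow_mem
        (d := ∑ i ∈ x.coeff.support.filter (· ∈ P.rootClosure), c i) ?_ ?_)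
      · exact (Nat.pos_of_ne_zero hci).trans_le (Finset.single_le_sum (by simp) hi)
      · rw [← Finset.prod_pow_eq_pow_sum, hc]
        exact prod_mem fun e he => pow_mem (Finset.mem_filter.mp he).2 _) x.coeff.support
  obtain ⟨v, hv, hmax⟩ := Finset.exists_max_image x.coeff.support (fun m => f (.ofMul m))
    ⟨n, Finsupp.mem_support_iff.mpr hn⟩
  have hu : UniqueMul x.coeff.support x.coeff.support v v := by
    intro a b ha hb hab
    have h1 : f (.ofMul a) + f (.ofMul b) = f (.ofMul v) + f (.ofMul v) := by
      rw [← map_add f, ← map_add f, ← ofMul_mul, ← ofMul_mul, hab]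
    have h2 := hmax a ha
    have h3 := hmax b hb
    exact ⟨hfinj ha hv (by simp only; linarith), hfinj hb hv (by simp only; linarith)⟩
  have hvv := coeff_mul_mul_of_uniqueMul hu
  have hv0 := Finsupp.mem_support_iff.mp hv
  have hvP : v ∈ P.rootClosure := ⟨2, two_pos, by
    rw [sq]
    refine h2 _ ?_
    rw [sq, hvv]
    exact mul_ne_zero hv0 hv0⟩
  have := hf v (Finset.mem_filter.mpr ⟨hv, hvP⟩)
  exact absurd (hmax n (Finsupp.mem_support_iff.mpr hn)) (not_le.mpr this)

/-- Let `y₀` be the part of `y` supported in the group generated by `P`. Multiplication by elements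
of `P` preserves membership and non-membership in that group. Hence `y ^ 2 * (y - y₀)` is supported
outside it, while `y ^ 3` and `y ^ 2 * y₀` are supported inside; the product vanishes, and `y = y₀`
in a domain. -/
theorem exists_mul_mem_of_coeff_ne_zero [Monoid.FG N] {P : Submonoid N} {y : MonoidAlgebra D N}
    (h2 : ∀ n, (y ^ 2).coeff n ≠ 0 → n ∈ P) (h3 : ∀ n, (y ^ 3).coeff n ≠ 0 → n ∈ P) {n : N}
    (hn : y.coeff n ≠ 0) : ∃ q ∈ P, n * q ∈ P := by
  classical
  let cN : CancelCommMonoid N := { ‹CommMonoid N›, ‹IsCancelMul N› with }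
  have : TwoUniqueProds N := AffineMonoid.to_twoUniqueProds
  have : NoZeroDivisors (MonoidAlgebra D N) := inferInstance
  let H : N → Prop := fun m => ∃ q ∈ P, m * q ∈ P
  have hHmul : ∀ u ∈ P, ∀ v, H (u * v) ↔ H v := fun u hu v => by
    constructor
    · rintro ⟨q, hq, h⟩
      exact ⟨u * q, P.mul_mem hu hq, by rwa [mul_left_comm, ← mul_assoc]⟩
    · rintro ⟨q, hq, h⟩
      exact ⟨q, hq, by rw [mul_assoc]; exact P.mul_mem hu h⟩
  let y₀ : MonoidAlgebra D N := .ofCoeff (y.coeff.filter H)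
  have hy₀ : ∀ m, y₀.coeff m = if H m then y.coeff m else 0 := fun m => Finsupp.filter_apply _ _ _
  have hz : y ^ 2 * (y - y₀) = 0 := by
    ext m
    by_contra hm
    rw [coeff_zero, Finsupp.zero_apply] at hm
    have hmH : ¬ H m := by
      obtain ⟨u, v, hu, hv, rfl⟩ := exists_mul_eq_of_coeff_mul_ne_zero hm
      rw [hHmul u (h2 u hu)]
      intro hvH
      rw [coeff_sub, Finsupp.sub_apply, hy₀, if_pos hvH, sub_self] at hv
      exact hv rfl
    rw [mul_sub, ← pow_succ, coeff_sub, Finsupp.sub_apply] at hm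
    have h3m : (y ^ 3).coeff m = 0 := by
      by_contra h
      exact hmH ⟨1, P.one_mem, by rw [mul_one]; exact h3 m h⟩
    have h0m : (y ^ 2 * y₀).coeff m = 0 := by
      by_contra h
      obtain ⟨u, v, hu, hv, rfl⟩ := exists_mul_eq_of_coeff_mul_ne_zero h
      rw [hHmul u (h2 u hu)] at hmH
      rw [hy₀, if_neg hmH] at hv
      exact hv rfl
    rw [h3m, h0m, sub_zero] at hm
    exact hm rfl
  have hy0 : y ≠ 0 := fun h => hn (by rw [h]; rfl)
  have hyy : y = y₀ := sub_eq_zero.mp ((mul_eq_zero.mp hz).resolve_left (pow_ne_zero 2 hy0))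
  by_contra hH
  exact hn (by rw [hyy, hy₀, if_neg hH])

theorem mem_of_coeff_ne_zero_of_closure_eq_top {P : Submonoid N}
    (hP : ∀ n : N, n ^ 2 ∈ P → n ^ 3 ∈ P → n ∈ P) {x : MonoidAlgebra D N}
    (hx : Submonoid.closure (x.coeff.support : Set N) = ⊤)
    (h2 : ∀ n, (x ^ 2).coeff n ≠ 0 → n ∈ P) (h3 : ∀ n, (x ^ 3).coeff n ≠ 0 → n ∈ P) {n : N}
    (hn : x.coeff n ≠ 0) : n ∈ P := by
  classical
  have hfg : Monoid.FG N := Monoid.fg_def.mpr ⟨_, hx⟩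
  have hroot : ∀ r : N, r ∈ P.rootClosure := fun r => by
    have : Submonoid.closure (x.coeff.support : Set N) ≤ P.rootClosure :=
      Submonoid.closure_le.mpr fun m hm =>
        mem_rootClosure_of_coeff_ne_zero h2 (Finsupp.mem_support_iff.mp hm)
    rw [hx] at this
    exact this (Submonoid.mem_top r)
  -- Projecting to the face of `n` yields a `q` that divides a power of `n`. With `n ^ j = q * r`
  -- and `r ^ d ∈ P`, both `n ^ (j * d)` and `n ^ (j * d + 1)` lie in `P`.
  let T := divisorsOfPowers n
  let π := faceProjection D T fun _ _ => mul_mem_divisorsOfPowers_iff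
  have hπ : ∀ z m, (π z).coeff m ≠ 0 → m ∈ T ∧ z.coeff m ≠ 0 := fun z m => by
    rw [coeff_faceProjection]
    split_ifs with h
    · exact fun hz => ⟨h, hz⟩
    · exact fun h => (h rfl).elim
  obtain ⟨q, ⟨hqP, j, r, hr⟩, hnq, -⟩ := exists_mul_mem_of_coeff_ne_zero (P := P ⊓ T) (y := π x)
    (fun m hm => by
      rw [← map_pow] at hm
      exact ⟨h2 m (hπ _ m hm).2, (hπ _ m hm).1⟩)
    (fun m hm => by
      rw [← map_pow] at hm
      exact ⟨h3 m (hπ _ m hm).2, (hπ _ m hm).1⟩) (n := n)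
    (by rwa [coeff_faceProjection, if_pos (self_mem_divisorsOfPowers n)])
  obtain ⟨d, hd, hrd⟩ := hroot r
  obtain ⟨e, rfl⟩ := Nat.exists_eq_succ_of_ne_zero hd.ne'
  refine Submonoid.mem_of_pow_mem_of_pow_succ_mem hP (k := j * (e + 1)) ?_ ?_
  · rw [pow_mul, hr, mul_pow]
    exact P.mul_mem (P.pow_mem hqP _) hrd
  · have : n ^ (j * (e + 1) + 1) = n * q * (q ^ e * r ^ (e + 1)) := by
      rw [pow_succ, pow_mul, hr, mul_pow, pow_succ q, mul_comm _ n]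
      simp only [mul_assoc, mul_left_comm]
    rw [this]
    exact P.mul_mem hnq (P.mul_mem (P.pow_mem hqP _) hrd)

end Support

/-- In a reduced ring some prime avoids the given nonzero coefficient, so it survives modulo that
prime, over a domain; `N` is then replaced by the submonoid generated by the support. -/
theorem mem_of_sq_of_cube_of_isReduced {D N : Type*} [CommRing D] [IsReduced D] [CommMonoid N]
    [IsCancelMul N] [IsMulTorsionFree N] {M : Submonoid N}
    (hM : ∀ n : N, n ^ 2 ∈ M → n ^ 3 ∈ M → n ∈ M) {x : MonoidAlgebra D N}
    (h2 : ∀ n, (x ^ 2).coeff n ≠ 0 → n ∈ M) (h3 : ∀ n, (x ^ 3).coeff n ≠ 0 → n ∈ M) {n : N}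
    (hn : x.coeff n ≠ 0) : n ∈ M := by
  obtain ⟨p, hp, hnp⟩ : ∃ p : Ideal D, p.IsPrime ∧ x.coeff n ∉ p := by
    by_contra! h
    exact hn (nilpotent_iff_mem_prime.mpr h).eq_zero
  let x' := mapRingHom N (Ideal.Quotient.mk p) x
  have hx' : ∀ k m, (x' ^ k).coeff m ≠ 0 → (x ^ k).coeff m ≠ 0 := fun k m hm h => hm (by
    rw [← map_pow, coeff_mapRingHom, h, map_zero])
  have hxn : x'.coeff n ≠ 0 := by
    rw [coeff_mapRingHom]
    exact fun h => hnp (Ideal.Quotient.eq_zero_iff_mem.mp h)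
  let N' := Submonoid.closure (x'.coeff.support : Set N)
  obtain ⟨y, hy⟩ := exists_mapDomainRingHom_eq (N' := N') (x := x')
    fun n hn => Submonoid.subset_closure (Finsupp.mem_support_iff.mpr hn)
  have hyc : ∀ k (m : N'), (y ^ k).coeff m = (x' ^ k).coeff m := fun k m => by
    rw [← coeff_mapDomainRingHom_subtype, map_pow, hy]
  have hyc1 : ∀ m : N', y.coeff m = x'.coeff m := fun m => by
    rw [← coeff_mapDomainRingHom_subtype, hy]
  have hsupp : (y.coeff.support : Set N') = Subtype.val ⁻¹' (x'.coeff.support : Set N) := by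
    ext m
    simp [hyc1]
  have hnN : n ∈ N' := Submonoid.subset_closure (Finsupp.mem_support_iff.mpr hxn)
  exact mem_of_coeff_ne_zero_of_closure_eq_top (P := M.comap N'.subtype) (x := y) (n := ⟨n, hnN⟩)
    (fun m => hM m) (by rw [hsupp]; exact Submonoid.closure_closure_coe_preimage)
    (fun m hm => h2 m (hx' 2 m (by rwa [← hyc])))
    (fun m hm => h3 m (hx' 3 m (by rwa [← hyc]))) (by rwa [hyc1])

end MonoidAlgebra

/-! Invertible submodules and generating families -/

namespace InvertibleSubmodules

section

variable {S : Type*} [CommRing S] {R : Subring S}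

theorem mem_one_iff {x : S} : x ∈ (1 : Submodule R S) ↔ x ∈ R := by
  rw [Submodule.mem_one]
  exact ⟨fun ⟨r, hr⟩ => hr ▸ r.2, fun h => ⟨⟨x, h⟩, rfl⟩⟩

theorem exists_sum_eq_of_mem_mul {I J : Submodule R S} {x : S} (hx : x ∈ I * J) :
    ∃ (ι : Type) (_ : Fintype ι) (f g : ι → S), (∀ i, f i ∈ I) ∧ (∀ i, g i ∈ J) ∧
      ∑ i, f i * g i = x := by
  refine Submodule.mul_induction_on hx (fun m hm n hn => ?_) (fun x y hx hy => ?_)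
  · exact ⟨Unit, inferInstance, fun _ => m, fun _ => n, fun _ => hm, fun _ => hn, by simp⟩
  · obtain ⟨ι, _, f, g, hf, hg, rfl⟩ := hx
    obtain ⟨κ, _, f', g', hf', hg', rfl⟩ := hy
    exact ⟨ι ⊕ κ, inferInstance, Sum.elim f f', Sum.elim g g', Sum.rec hf hf', Sum.rec hg hg',
      by simp⟩

/-- The invertible submodule generated by a family having an inverse family. -/
def ofFamilies {ι : Type*} [Fintype ι] (f g : ι → S) (hfg : ∀ i j, f i * g j ∈ R)
    (h1 : ∑ i, f i * g i = 1) : InvertibleSubmodules R :=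
  Units.mkOfMulEqOne (Submodule.span R (Set.range f)) (Submodule.span R (Set.range g)) (by
    rw [Submodule.span_mul_span]
    apply le_antisymm
    · rw [Submodule.span_le]
      rintro _ ⟨_, ⟨i, rfl⟩, _, ⟨j, rfl⟩, rfl⟩
      exact mem_one_iff.mpr (hfg i j)
    · rw [Submodule.one_le, ← h1]
      exact sum_mem fun i _ => Submodule.subset_span (Set.mul_mem_mul ⟨i, rfl⟩ ⟨i, rfl⟩))

/-- Each `x` in `U` equals `∑ i, f i * (x * g i)`, and `x * g i` lies in `U * U⁻¹ = R`. -/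
theorem val_le_one {U : InvertibleSubmodules R} {ι : Type*} [Fintype ι] {f g : ι → S}
    (hf : ∀ i, f i ∈ R) (hg : ∀ i, g i ∈ (U⁻¹).val) (h1 : ∑ i, f i * g i = 1) :
    U.val ≤ 1 := by
  intro x hx
  rw [mem_one_iff, ← mul_one x, ← h1, Finset.mul_sum]
  refine sum_mem fun i _ => ?_
  rw [mul_left_comm]
  have : x * g i ∈ U.val * (U⁻¹).val := Submodule.mul_mem_mul hx (hg i)
  rw [Units.mul_inv] at this
  exact mul_mem (hf i) (mem_one_iff.mp this)

theorem eq_one_of_mem {U : InvertibleSubmodules R} {ι : Type*} [Fintype ι] {f g : ι → S}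
    (hfU : ∀ i, f i ∈ U.val) (hgU : ∀ i, g i ∈ (U⁻¹).val) (h1 : ∑ i, f i * g i = 1)
    (hf : ∀ i, f i ∈ R) (hg : ∀ i, g i ∈ R) : U = 1 := by
  have hU : U.val ≤ 1 := val_le_one hf hgU h1
  have hU' : (U⁻¹).val ≤ 1 :=
    val_le_one hg (by rwa [inv_inv]) (by simpa only [mul_comm] using h1)
  refine Units.ext (le_antisymm hU ?_)
  calc (1 : Submodule R S) = U.val * (U⁻¹).val := (Units.mul_inv U).symm
    _ ≤ U.val * 1 := mul_le_mul_right hU' _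
    _ = U.val := mul_one _

end

section

variable {B B' : Type*} [CommRing B] [CommRing B'] {A : Subring B} {A' : Subring B'}
  {φ : B →+* B'} (hφ : A ≤ A'.comap φ) {ε : B' →+* B}

theorem mem_map {U : InvertibleSubmodules A} {x : B} (hx : x ∈ U.val) :
    φ x ∈ (map φ hφ U).val :=
  Submodule.subset_span ⟨x, hx, rfl⟩

theorem mem_map_inv {U : InvertibleSubmodules A} {x : B} (hx : x ∈ (U⁻¹).val) :
    φ x ∈ ((map φ hφ U)⁻¹).val := by
  rw [← map_inv]
  exact mem_map hφ hx

theorem map_map_of_comp_eq_id (hε : A' ≤ A.comap ε) (h : ε.comp φ = RingHom.id B) (U : InvertibleSubmodules A) :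
    map ε hε (map φ hφ U) = U := by
  have hx : ∀ x, ε (φ x) = x := RingHom.congr_fun h
  refine Units.ext (le_antisymm (Submodule.span_le.mpr ?_) fun x hxU => ?_)
  · rintro _ ⟨y, hy, rfl⟩
    have hy' : y ∈ Submodule.span A' (φ '' (U.val : Set B)) := hy
    clear hy
    change ε y ∈ U.val
    induction hy' using Submodule.span_induction with
    | mem y hy =>
      obtain ⟨x, hxU, rfl⟩ := hy
      rw [hx]
      exact hxU
    | zero => rw [map_zero]; exact zero_mem _
    | add y z _ _ hy hz =>
      rw [map_add]
      exact add_mem hy hz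
    | smul r y _ hy =>
      rw [Subring.smul_def, smul_eq_mul, map_mul]
      exact Submodule.smul_mem _ (⟨ε r, hε r.2⟩ : A) hy
  · have := mem_map hε (mem_map hφ hxU)
    rwa [hx] at this

/-- For a retract of ring extensions, the induced map on groups of invertible submodules is
bijective if and only if all invertible submodules that retract to the trivial one are trivial. -/
theorem bijective_map_iff (hε : A' ≤ A.comap ε) (h : ε.comp φ = RingHom.id B) :
    Function.Bijective (map φ hφ) ↔ ∀ (ι : Type) [Fintype ι] (f g : ι → B'),
      (∀ i j, f i * g j ∈ A') → ∑ i, f i * g i = 1 → (∀ i, ε (f i) ∈ A) → (∀ i, ε (g i) ∈ A) →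
        ∀ i, f i ∈ A' := by
  constructor
  · intro hbij ι _ f g hfg h1 hf hg i
    let U : InvertibleSubmodules A' := ofFamilies f g hfg h1
    have hfU : ∀ i, f i ∈ U.val := fun i => Submodule.subset_span ⟨i, rfl⟩
    have hgU : ∀ i, g i ∈ (U⁻¹).val := fun i => Submodule.subset_span ⟨i, rfl⟩
    have hU : map ε hε U = 1 := eq_one_of_mem (fun i => mem_map hε (hfU i))
      (fun i => mem_map_inv hε (hgU i)) (by simpa using congrArg ε h1) hf hg
    obtain ⟨W, hW⟩ := hbij.2 U
    rw [← hW, map_map_of_comp_eq_id hφ hε h] at hU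
    rw [hU, map_one] at hW
    have := hfU i
    rw [← hW] at this
    exact mem_one_iff.mp this
  · intro hcrit
    refine ⟨Function.LeftInverse.injective (map_map_of_comp_eq_id hφ hε h), fun U => ?_⟩
    refine ⟨map ε hε U, ?_⟩
    -- Dividing `U` by the extension of its own retraction leaves a submodule with trivial
    -- retraction.
    let V := U * (map φ hφ (map ε hε U))⁻¹
    have hV : map ε hε V = 1 := by
      rw [map_mul, map_inv, map_map_of_comp_eq_id hφ hε h, mul_inv_cancel]
    obtain ⟨ι, _, f, g, hf, hg, h1⟩ := exists_sum_eq_of_mem_mul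
      (show (1 : B') ∈ V.val * (V⁻¹).val by rw [Units.mul_inv]; exact mem_one_iff.mpr (one_mem _))
    have hfg : ∀ i j, f i * g j ∈ A' := fun i j => by
      have := Submodule.mul_mem_mul (hf i) (hg j)
      rw [Units.mul_inv] at this
      exact mem_one_iff.mp this
    have hεf : ∀ i, ε (f i) ∈ A := fun i => by
      have := mem_map hε (hf i)
      rw [hV] at this
      exact mem_one_iff.mp this
    have hεg : ∀ i, ε (g i) ∈ A := fun i => by
      have := mem_map_inv hε (hg i)
      rw [hV, inv_one] at this
      exact mem_one_iff.mp this
    have hV1 : V = 1 := eq_one_of_mem hf hg h1 (hcrit ι f g hfg h1 hεf hεg)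
      (hcrit ι g f (fun i j => by rw [mul_comm]; exact hfg j i)
        (by simpa only [mul_comm] using h1) hεg hεf)
    exact (mul_inv_eq_one.mp hV1).symm

/-- The source of all of (d): the criterion is applied to the invertible submodule generated by `1 -
x` and `x ^ 2`. -/
theorem mem_of_sq_of_cube_of_bijective_map (hε : A' ≤ A.comap ε) (h : ε.comp φ = RingHom.id B)
    (hbij : Function.Bijective (map φ hφ)) {x : B'} (h2 : x ^ 2 ∈ A') (h3 : x ^ 3 ∈ A')
    (hx : ε x ∈ A) : x ∈ A' := by
  obtain ⟨hfg, h1⟩ := A'.mul_mem_and_sum_eq_one h2 h3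
  have hx2 : ε x ^ 2 ∈ A := pow_mem hx 2
  have := (bijective_map_iff hφ hε h).mp hbij (Fin 2) _ _ hfg h1
    (by
      rw [Fin.forall_fin_two]
      simpa using ⟨sub_mem (one_mem A) hx, hx2⟩)
    (by
      rw [Fin.forall_fin_two]
      simpa using ⟨mul_mem (add_mem (one_mem A) hx) (add_mem (one_mem A) hx2), hx2⟩) 0
  have h4 : x = 1 - (1 - x) := by ring
  rw [h4]
  exact sub_mem (one_mem _) this

end

end InvertibleSubmodules

/-! Invertible submodules over monoid algebras -/

namespace MonoidAlgebra

variable {B N : Type*} [CommRing B] [CommMonoid N]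

theorem single_mem_subringMonoidAlgebra {A : Subring B} {M : Submonoid N} {n : N} {b : B}
    (hb : b ∈ A) (hn : b ≠ 0 → n ∈ M) : single n b ∈ A.monoidAlgebra M := by
  classical
  rw [mem_subringMonoidAlgebra]
  refine ⟨fun m => ?_, fun m hm => ?_⟩
  · rw [coeff_single, Finsupp.single_apply]
    split_ifs
    · exact hb
    · exact zero_mem _
  · rw [coeff_single, Finsupp.single_apply] at hm
    split_ifs at hm with h
    · exact h ▸ hn hm
    · exact (hm rfl).elim

/-! ### The retraction given by positivity. -/

section Augmentation

variable [Subsingleton Nˣ]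

open Classical in
/-- The retraction of a monoid algebra over a positive monoid onto its coefficient ring. -/
noncomputable def positiveAugmentation (B N : Type*) [CommRing B] [CommMonoid N]
    [Subsingleton Nˣ] : MonoidAlgebra B N →+* B :=
  (MonoidAlgebra.lift B B N ⟨⟨fun n => if n = 1 then 1 else 0, by simp⟩, fun a b => by
    by_cases ha : a = 1 <;> by_cases hb : b = 1 <;> simp [ha, hb]⟩).toRingHom

theorem positiveAugmentation_apply (x : MonoidAlgebra B N) :
    positiveAugmentation B N x = x.coeff 1 := by
  classical
  have : positiveAugmentation B N x = x.coeff.sum fun n b => b • if n = 1 then 1 else 0 :=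
    MonoidAlgebra.lift_apply _ _
  rw [this, Finsupp.sum]
  simp [eq_comm]

theorem positiveAugmentation_comp_singleOneRingHom :
    (positiveAugmentation B N).comp singleOneRingHom = RingHom.id B := by
  ext b
  rw [RingHom.comp_apply, positiveAugmentation_apply]
  simp [singleOneRingHom]

theorem monoidAlgebra_le_comap_positiveAugmentation (A : Subring B) (M : Submonoid N) :
    A.monoidAlgebra M ≤ A.comap (positiveAugmentation B N) := fun x hx => by
  rw [Subring.mem_comap, positiveAugmentation_apply]
  exact (mem_subringMonoidAlgebra.mp hx).1 1

end Augmentation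

/-! ### From monoid algebras to polynomials by a grading. -/

section Homogenization

open Polynomial (X C)

/-- The homomorphism sending `n` to `n X ^ d n`. -/
noncomputable def homogenize (B : Type*) [CommRing B] (d : Additive N →+ ℕ) :
    MonoidAlgebra B N →+* Polynomial (MonoidAlgebra B N) :=
  (MonoidAlgebra.lift B (Polynomial (MonoidAlgebra B N)) N
    ⟨⟨fun n => C (single n 1) * X ^ d (.ofMul n), by simp [← one_def]⟩, fun a b => by
      simp only [ofMul_mul, map_add, pow_add]
      rw [mul_mul_mul_comm, ← map_mul, single_mul_single, one_mul]⟩).toRingHom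

theorem coeff_homogenize (d : Additive N →+ ℕ) (x : MonoidAlgebra B N) (k : ℕ) :
    (homogenize B d x).coeff k =
      ∑ n ∈ x.coeff.support, if k = d (.ofMul n) then single n (x.coeff n) else 0 := by
  have : homogenize B d x = x.coeff.sum fun n b => b • (C (single n 1) * X ^ d (.ofMul n)) :=
    MonoidAlgebra.lift_apply _ _
  rw [this, Finsupp.sum, Polynomial.finsetSum_coeff]
  refine Finset.sum_congr rfl fun n _ => ?_
  rw [Polynomial.coeff_smul, Polynomial.coeff_C_mul_X_pow]
  split_ifs <;> simp

theorem eval_one_homogenize (d : Additive N →+ ℕ) (x : MonoidAlgebra B N) :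
    (homogenize B d x).eval 1 = x := by
  have : homogenize B d x = x.coeff.sum fun n b => b • (C (single n 1) * X ^ d (.ofMul n)) :=
    MonoidAlgebra.lift_apply _ _
  rw [this, Finsupp.sum, Polynomial.eval_finsetSum]
  conv_rhs => rw [← sum_coeff_single x, Finsupp.sum]
  refine Finset.sum_congr rfl fun n _ => ?_
  simp

end Homogenization

variable [Subsingleton Nˣ]

theorem mem_of_bijective_toMonoidAlgebra {A : Subring B} {M : Submonoid N}
    (h : Function.Bijective (InvertibleSubmodules.toMonoidAlgebra A M)) {x : MonoidAlgebra B N}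
    (h2 : x ^ 2 ∈ A.monoidAlgebra M) (h3 : x ^ 3 ∈ A.monoidAlgebra M) (hx : x.coeff 1 ∈ A) :
    x ∈ A.monoidAlgebra M :=
  InvertibleSubmodules.mem_of_sq_of_cube_of_bijective_map _
    (monoidAlgebra_le_comap_positiveAugmentation A M)
    positiveAugmentation_comp_singleOneRingHom h h2 h3 (by rwa [positiveAugmentation_apply])

theorem isSubintegrallyClosed_of_bijective_toMonoidAlgebra {A : Subring B} {M : Submonoid N}
    (h : Function.Bijective (InvertibleSubmodules.toMonoidAlgebra A M)) (hM : M ≠ ⊥) :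
    A.IsSubintegrallyClosed := by
  rw [Subring.isSubintegrallyClosed_iff]
  intro b h2 h3
  obtain ⟨m, hm, hm1⟩ := M.bot_or_exists_ne_one.resolve_left hM
  -- As `m ≠ 1`, the element `b m` has augmentation `0`, so nothing about `b` itself is needed in
  -- advance.
  have key := mem_of_bijective_toMonoidAlgebra h (x := single m b)
    (by
      rw [single_pow]
      exact single_mem_subringMonoidAlgebra h2 fun _ => pow_mem hm 2)
    (by
      rw [single_pow]
      exact single_mem_subringMonoidAlgebra h3 fun _ => pow_mem hm 3)
    (by
      rw [coeff_single, Finsupp.single_eq_of_ne hm1.symm]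
      exact zero_mem _)
  simpa using (mem_subringMonoidAlgebra.mp key).1 m

theorem isSubintegrallyClosed_monoidAlgebra_of_bijective {A : Subring B} {M : Submonoid N}
    (h : Function.Bijective (InvertibleSubmodules.toMonoidAlgebra A M)) (hM : M ≠ ⊥) :
    (A.monoidAlgebra M).IsSubintegrallyClosed := by
  have hA := Subring.isSubintegrallyClosed_iff.mp
    (isSubintegrallyClosed_of_bijective_toMonoidAlgebra h hM)
  rw [Subring.isSubintegrallyClosed_iff]
  intro x h2 h3
  refine mem_of_bijective_toMonoidAlgebra h h2 h3 ?_
  have hε := monoidAlgebra_le_comap_positiveAugmentation A M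
  rw [← positiveAugmentation_apply]
  refine hA _ ?_ ?_
  · rw [← map_pow]
    exact hε h2
  · rw [← map_pow]
    exact hε h3

theorem isReduced_or_eq_top_of_bijective_toMonoidAlgebra {A : Subring B} {M : Submonoid N}
    (h : Function.Bijective (InvertibleSubmodules.toMonoidAlgebra A M)) :
    IsReduced B ∨ M = ⊤ := by
  refine or_iff_not_imp_right.mpr fun hM => (isReduced_iff_pow_one_lt 2 one_lt_two).mpr fun b hb => ?_
  obtain ⟨n, -, hn⟩ := SetLike.exists_of_lt (lt_top_iff_ne_top.mpr hM)
  by_contra hb0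
  -- A nonzero `b` of square zero and an `n` outside `M` give `b n` with zero square, cube and
  -- augmentation, yet not in `A[M]`.
  have hsq : (single n b) ^ 2 = (0 : MonoidAlgebra B N) := by rw [single_pow, hb, single_zero]
  have key := mem_of_bijective_toMonoidAlgebra h (x := single n b)
    (by
      rw [hsq]
      exact zero_mem _)
    (by
      rw [pow_succ, hsq, zero_mul]
      exact zero_mem _)
    (by
      rw [coeff_single, Finsupp.single_eq_of_ne fun h1 : 1 = n => hn (h1 ▸ M.one_mem)]
      exact zero_mem _)
  exact hn ((mem_subringMonoidAlgebra.mp key).2 n (by simpa using hb0))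

/-! ### Subintegral closedness of `A[M]` and bijectivity. -/

section Cancellative

variable [IsCancelMul N] [IsMulTorsionFree N]

/-- If `A[M]` is subintegrally closed in `B[N]`, then every invertible `A[M]`-submodule of `B[N]`
whose augmentation is `A` is trivial. -/
theorem mem_of_forall_mul_mem {A : Subring B} {M : Submonoid N}
    (h : ∀ x : MonoidAlgebra B N, x ^ 2 ∈ A.monoidAlgebra M → x ^ 3 ∈ A.monoidAlgebra M →
      x ∈ A.monoidAlgebra M)
    {ι : Type*} [Fintype ι] {f g : ι → MonoidAlgebra B N}
    (hfg : ∀ i j, f i * g j ∈ A.monoidAlgebra M) (h1 : ∑ i, f i * g i = 1)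
    (hf : ∀ i, (f i).coeff 1 ∈ A) (hg : ∀ i, (g i).coeff 1 ∈ A) (i : ι) :
    f i ∈ A.monoidAlgebra M := by
  classical
  let T : Finset N := Finset.univ.biUnion fun i => (f i).coeff.support ∪ (g i).coeff.support
  let N' := Submonoid.closure (T : Set N)
  have := N'.subsingleton_units
  have : Monoid.FG N' := Submonoid.fg_closure_finset _
  have hT : ∀ i n, (f i).coeff n ≠ 0 ∨ (g i).coeff n ≠ 0 → n ∈ N' := fun i n hn =>
    Submonoid.subset_closure (Finset.mem_coe.mpr (Finset.mem_biUnion.mpr ⟨i, Finset.mem_univ i, by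
      rwa [Finset.mem_union, Finsupp.mem_support_iff, Finsupp.mem_support_iff]⟩))
  choose F hF using fun i => exists_mapDomainRingHom_eq (fun n hn => hT i n (Or.inl hn))
  choose G hG using fun i => exists_mapDomainRingHom_eq (fun n hn => hT i n (Or.inr hn))
  obtain ⟨d, hd, -⟩ := exists_hom_nat_pos (∅ : Finset N')
  let j := mapDomainRingHom B N'.subtype
  have hj : Function.Injective j := mapDomain_injective Subtype.val_injective
  -- `R` is the part of `A[M]` supported in `N'`. It contains the homogeneous components of its
  -- elements, and evaluating at `X = 1` sums them again.
  let R := (A.monoidAlgebra M).comap j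
  have hsingle : ∀ (n : N') (b : B), b ∈ A → (b ≠ 0 → (n : N) ∈ M) → single n b ∈ R :=
    fun n b hb hn => by
      have : j (single n b) = single (n : N) b := mapDomain_single
      rw [Subring.mem_comap, this]
      exact single_mem_subringMonoidAlgebra hb hn
  have hcoeff : ∀ y ∈ R, ∀ k, (homogenize B d y).coeff k ∈ R := fun y hy k => by
    have hy' := mem_subringMonoidAlgebra.mp (Subring.mem_comap.mp hy)
    rw [coeff_homogenize]
    refine sum_mem fun n _ => ?_
    split_ifs
    · refine hsingle n _ ?_ fun hn => ?_
      · rw [← coeff_mapDomainRingHom_subtype]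
        exact hy'.1 n
      · rw [← coeff_mapDomainRingHom_subtype] at hn
        exact hy'.2 n hn
    · exact zero_mem _
  have hcoeff0 : ∀ y : MonoidAlgebra B N', y.coeff 1 ∈ A → (homogenize B d y).coeff 0 ∈ R :=
    fun y hy => by
      rw [coeff_homogenize]
      refine sum_mem fun n _ => ?_
      split_ifs with h0
      -- Only `1` has degree zero, so the constant coefficient is the coefficient at `1`.
      · obtain rfl := hd n h0.symm
        exact hsingle 1 _ hy fun _ => M.one_mem
      · exact zero_mem _
  have key := Polynomial.coeff_mem_of_forall_mul_coeff_mem (R := R)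
    (f := fun i => homogenize B d (F i)) (g := fun i => homogenize B d (G i))
    (fun x h2 h3 => h (j x) (by rw [← map_pow]; exact h2) (by rw [← map_pow]; exact h3))
    (fun i k n => by
      rw [← map_mul]
      refine hcoeff _ ?_ n
      rw [Subring.mem_comap, map_mul, hF, hG]
      exact hfg i k)
    (by
      simp only [← map_mul, ← map_sum]
      rw [← map_one (homogenize B d)]
      congr 1
      apply hj
      rw [map_sum, map_one, ← h1]
      exact Finset.sum_congr rfl fun i _ => by rw [map_mul, hF, hG])
    (fun i => hcoeff0 _ (by
      rw [← coeff_mapDomainRingHom_subtype, hF]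
      exact hf i))
    (fun i => hcoeff0 _ (by
      rw [← coeff_mapDomainRingHom_subtype, hG]
      exact hg i)) i
  have hFi : F i ∈ R := by
    rw [← eval_one_homogenize d (F i), Polynomial.eval_eq_sum_range]
    exact sum_mem fun k _ => by
      rw [one_pow, mul_one]
      exact key k
  rw [← hF i]
  exact hFi

theorem bijective_toMonoidAlgebra {A : Subring B} {M : Submonoid N}
    (h : (A.monoidAlgebra M).IsSubintegrallyClosed) :
    Function.Bijective (InvertibleSubmodules.toMonoidAlgebra A M) := by
  refine (InvertibleSubmodules.bijective_map_iff _
    (monoidAlgebra_le_comap_positiveAugmentation A M)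
    positiveAugmentation_comp_singleOneRingHom).mpr fun ι _ f g hfg h1 hf hg =>
      mem_of_forall_mul_mem (Subring.isSubintegrallyClosed_iff.mp h) hfg h1 ?_ ?_
  · simpa only [positiveAugmentation_apply] using hf
  · simpa only [positiveAugmentation_apply] using hg

theorem isSubintegrallyClosed_monoidAlgebra {A : Subring B} {M : Submonoid N}
    (hA : A.IsSubintegrallyClosed) (hM : M.IsSubintegrallyClosed ∧ IsReduced B ∨ M = ⊤) :
    (A.monoidAlgebra M).IsSubintegrallyClosed := by
  rw [Subring.isSubintegrallyClosed_iff] at hA ⊢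
  intro x h2 h3
  rw [mem_subringMonoidAlgebra] at h2 h3 ⊢
  refine ⟨coeff_mem_of_sq_of_cube hA h2.1 h3.1, fun n hn => ?_⟩
  rcases hM with ⟨hM, _⟩ | rfl
  · exact mem_of_sq_of_cube_of_isReduced (fun m => hM.mem) h2.2 h3.2 hn
  · exact Submonoid.mem_top n

end Cancellative

end MonoidAlgebra

theorem theorem1p2 {B : Type*} [CommRing B] (A : Subring B)
    {N : Type*} [CancelCommMonoid N] [IsMulTorsionFree N] [Subsingleton Nˣ] (M : Submonoid N) :
    -- (a)
    ((A.monoidAlgebra M).IsSubintegrallyClosed → Monoid.FG N →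
      Function.Bijective (InvertibleSubmodules.toMonoidAlgebra A M)) ∧
    -- (b)
    (IsReduced B → A.IsSubintegrallyClosed → M.IsSubintegrallyClosed →
      Function.Bijective (InvertibleSubmodules.toMonoidAlgebra A M)) ∧
    -- (c)
    (M = ⊤ → A.IsSubintegrallyClosed →
      Function.Bijective (InvertibleSubmodules.toMonoidAlgebra A M)) ∧
    -- (d)
    (Function.Bijective (InvertibleSubmodules.toMonoidAlgebra A M) →
      (M ≠ ⊥ → A.IsSubintegrallyClosed ∧ (A.monoidAlgebra M).IsSubintegrallyClosed) ∧
      (IsReduced B ∨ M = ⊤)) :=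
  ⟨fun h _ => MonoidAlgebra.bijective_toMonoidAlgebra h,
    fun hB hA hM => MonoidAlgebra.bijective_toMonoidAlgebra
      (MonoidAlgebra.isSubintegrallyClosed_monoidAlgebra hA (Or.inl ⟨hM, hB⟩)),
    fun hM hA => MonoidAlgebra.bijective_toMonoidAlgebra
      (MonoidAlgebra.isSubintegrallyClosed_monoidAlgebra hA (Or.inr hM)),
    fun h => ⟨fun hM =>
      ⟨MonoidAlgebra.isSubintegrallyClosed_of_bijective_toMonoidAlgebra h hM,
        MonoidAlgebra.isSubintegrallyClosed_monoidAlgebra_of_bijective h hM⟩,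
      MonoidAlgebra.isReduced_or_eq_top_of_bijective_toMonoidAlgebra h⟩⟩
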